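/- **Seventh-order barrier for linear combinations of non-palindromic 3-stage compositions.** Work in formal power series in a central variable $h$ over the free associative real algebra on letters $Y_1,Y_3,Y_5,\dots$, with $[A,B]=AB-BA$, and let $Y(h)=\sum_{j\ge 0}h^{2j+1}Y_{2j+1}$. Associate to a time-symmetric second-order basic map $S_h$ the series $e^{Y(h)}$, to the exact flow $\varphi_h$ the series $e^{hY_1}$, and to the composition $S_{a_1h}\circ S_{a_2h}\circ S_{(1-a_1-a_2)h}$ ($a_1,a_2\in\mathbb R$) the series $\Psi_{a_1,a_2}(h)=e^{Y((1-a_1-a_2)h)}e^{Y(a_2h)}e^{Y(a_1h)}$ (operators act by $g\mapsto g\circ S$). Put $E_{31}=Y_3$, $E_{41}=[Y_1,E_{31}]$, $E_{51}=Y_5$, $E_{52}=[Y_1,E_{41}]$, $E_{61}=[Y_1,E_{51}]$, $E_{62}=[Y_1,E_{52}]$, $E_{71}=Y_7$, $E_{72}=[Y_1,E_{61}]$, $E_{73}=[Y_1,E_{62}]$, $E_{74}=[E_{31},E_{41}]$. (i) For all $a_1,a_2\in\mathbb R$ there are unique real numbers $w_{mn}=w_{mn}(a_1,a_2)$ such that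 $\Psi_{a_1,a_2}(h)=e^{hY_1/2}\,e^{h^3W(h)}\,e^{hY_1/2}$ for a formal power series $W$ with $$W(h)=w_{31}E_{31}+h\,w_{41}E_{41}+h^2\sum_{\ell=1}^2w_{5\ell}E_{5\ell}+h^3\sum_{\ell=1}^2w_{6\ell}E_{6\ell}+h^4\sum_{\ell=1}^4w_{7\ell}E_{7\ell}+\mathcal O(h^5).$$ For $k\ge 0$ and real $b_i,a_{i1},a_{i2}$ ($1\le i\le k$) consider $\psi_h=\sum_{i=1}^kb_i\,S_{a_{i1}h}\circ S_{a_{i2}h}\circ S_{(1-a_{i1}-a_{i2})h}$, with series $\Psi(h)=\sum_i b_i\Psi_{a_{i1},a_{i2}}(h)$. With $w^{(i)}_{mn}=w_{mn}(a_{i1},a_{i2})$ put $G_{00}=\sum_ib_i$, $G_{mn}=\sum_ib_iw^{(i)}_{mn}$, $\tilde G_{63}=\sum_ib_i(w_{31}^{(i)})^2$, $\tilde G_{75}=\sum_ib_iw_{31}^{(i)}w_{41}^{(i)}$. (ii) If $\sum_ib_i=1$, then $$\tfrac{35}{4}G_{31}-\tfrac{63}{2}G_{51}+35\tilde G_{63}+36G_{71}-420G_{72}+10080G_{73}-420G_{74}=1.$$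 (iii) For no $k$ and no choice of the coefficients is $\psi_h$ of order 7. This holds both formally ($\Psi(h)=e^{hY_1}+\mathcal O(h^8)$ never holds) and for actual integrators: it never happens that, for every $d$, every smooth vector field $f$ on $\mathbb R^d$ and every smooth time-symmetric second-order integrator $S_h$ for $x'=f(x)$ (i.e. $(h,x)\mapsto S_h(x)$ is $C^\infty$ on $\mathbb R\times\mathbb R^d$, $S_{-h}\circ S_h=\mathrm{id}$ for all $h$, and $S_h(x_0)=\varphi_h(x_0)+\mathcal O(h^3)$ for each $x_0$), one has $\psi_h(x_0)=\varphi_h(x_0)+\mathcal O(h^8)$ for every $x_0\in\mathbb R^d$. (iv) If $G_{00}=1$, $G_{31}=G_{41}=G_{51}=G_{52}=G_{61}=G_{62}=\tilde G_{63}=0$ (the conditions for order 6) and $G_{71}=G_{72}=G_{74}=\tilde G_{75}=0$, then $G_{73}=\frac1{10080}$. There are real coefficients with $k=4$ for which all these equations hold, and for which $\Psi(h)=e^{hY_1/2}\bigl(1+\tfrac{h^7}{10080}E_{73}\bigr)e^{hY_1/2}+\mathcal O(h^8)$. -/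

import Mathlib

open scoped Topology ContDiff

noncomputable section

namespace GenExtrap

/-! ### Series of operators in the step size -/

/-- The free associative algebra on letters `Y₁, Y₃, Y₅, …`. Its commutator bracket makes it
contain the free Lie algebra on these letters. -/
abbrev OpAlg : Type := FreeAlgebra ℝ ℕ

/-- Formal power series in the (central) step size `h`, with coefficients in the free algebra. -/
abbrev OpSeries : Type := PowerSeries OpAlg

/-- The letter `Y_{2k+1}`. -/
def letter (k : ℕ) : OpAlg := FreeAlgebra.ι ℝ k

/-- The exponential `∑ m, P ^ m / m!` of a series `P` without constant term (then `P ^ m` does not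
contribute to the coefficient of `h ^ n` when `m > n`). -/
def sexp (P : OpSeries) : OpSeries :=
  PowerSeries.mk fun n =>
    ∑ m ∈ Finset.range (n + 1), ((m.factorial : ℝ)⁻¹) • PowerSeries.coeff n (P ^ m)

/-- The series `Y(c h) = ∑ k, (c h) ^ (2k+1) Y_{2k+1}`. -/
def baseLog (c : ℝ) : OpSeries :=
  PowerSeries.mk fun n => if Odd n then c ^ n • letter (n / 2) else 0

/-- The series `exp (c h Y₁)`, i.e. the exact flow with step `c h`. -/
def flowSeries (c : ℝ) : OpSeries := sexp (PowerSeries.monomial 1 (c • letter 0))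

/-- The series of operators of `S_{a₁ h} ∘ S_{a₂ h} ∘ S_{(1 - a₁ - a₂) h}`, where `exp (Y(c h))` is
that of `S_{c h}`. Operators act on functions by composition, `g ↦ g ∘ S`, so that the order of the
factors is the reverse of that of the maps. -/
def stageSeries (a₁ a₂ : ℝ) : OpSeries :=
  sexp (baseLog (1 - a₁ - a₂)) * sexp (baseLog a₂) * sexp (baseLog a₁)

/-! ### The basis of the free Lie algebra up to degree seven -/

def E31 : OpAlg := letter 1
def E41 : OpAlg := ⁅letter 0, E31⁆
def E51 : OpAlg := letter 2
def E52 : OpAlg := ⁅letter 0, E41⁆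
def E61 : OpAlg := ⁅letter 0, E51⁆
def E62 : OpAlg := ⁅letter 0, E52⁆
def E71 : OpAlg := letter 3
def E72 : OpAlg := ⁅letter 0, E61⁆
def E73 : OpAlg := ⁅letter 0, E62⁆
def E74 : OpAlg := ⁅E31, E41⁆

/-! ### The coefficients of the error series -/

/-- The real coefficients `w_{mn}`, for `m ≤ 7`, of the error series of one composition. -/
@[ext]
structure ErrorCoeffs where
  w31 : ℝ
  w41 : ℝ
  w51 : ℝ
  w52 : ℝ
  w61 : ℝ
  w62 : ℝ
  w71 : ℝ
  w72 : ℝ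
  w73 : ℝ
  w74 : ℝ

instance : Nonempty ErrorCoeffs := ⟨⟨0, 0, 0, 0, 0, 0, 0, 0, 0, 0⟩⟩

/-- `w` holds the coefficients of the series `W` determined by
`stageSeries a₁ a₂ = exp (h Y₁ / 2) * exp (h ^ 3 W) * exp (h Y₁ / 2)`, in the basis `E_{mn}`. -/
def IsErrorCoeffs (a₁ a₂ : ℝ) (w : ErrorCoeffs) : Prop :=
  ∃ W : OpSeries,
    stageSeries a₁ a₂ = flowSeries (1 / 2) * sexp (PowerSeries.X ^ 3 * W) * flowSeries (1 / 2) ∧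
    PowerSeries.coeff 0 W = w.w31 • E31 ∧
    PowerSeries.coeff 1 W = w.w41 • E41 ∧
    PowerSeries.coeff 2 W = w.w51 • E51 + w.w52 • E52 ∧
    PowerSeries.coeff 3 W = w.w61 • E61 + w.w62 • E62 ∧
    PowerSeries.coeff 4 W = w.w71 • E71 + w.w72 • E72 + w.w73 • E73 + w.w74 • E74

/-- The coefficients `w_{mn}` of `S_{a₁ h} ∘ S_{a₂ h} ∘ S_{(1 - a₁ - a₂) h}`. -/
def errorCoeffs (a₁ a₂ : ℝ) : ErrorCoeffs := Classical.epsilon (IsErrorCoeffs a₁ a₂)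

/-! ### Linear combinations of three-stage compositions -/

/-- The parameters of `∑ i, b i • S_{a₁ i h} ∘ S_{a₂ i h} ∘ S_{(1 - a₁ i - a₂ i) h}`. -/
structure Scheme (k : ℕ) where
  b : Fin k → ℝ
  a₁ : Fin k → ℝ
  a₂ : Fin k → ℝ

namespace Scheme

variable {k : ℕ}

/-- The average `∑ i, b i * c (w^{(i)})` of a function `c` of the coefficients `w^{(i)}`. -/
def avg (M : Scheme k) (c : ErrorCoeffs → ℝ) : ℝ :=
  ∑ i, M.b i * c (errorCoeffs (M.a₁ i) (M.a₂ i))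

def G00 (M : Scheme k) : ℝ := ∑ i, M.b i
def G31 (M : Scheme k) : ℝ := M.avg fun w => w.w31
def G41 (M : Scheme k) : ℝ := M.avg fun w => w.w41
def G51 (M : Scheme k) : ℝ := M.avg fun w => w.w51
def G52 (M : Scheme k) : ℝ := M.avg fun w => w.w52
def G61 (M : Scheme k) : ℝ := M.avg fun w => w.w61
def G62 (M : Scheme k) : ℝ := M.avg fun w => w.w62
def G63t (M : Scheme k) : ℝ := M.avg fun w => w.w31 ^ 2
def G71 (M : Scheme k) : ℝ := M.avg fun w => w.w71
def G72 (M : Scheme k) : ℝ := M.avg fun w => w.w72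
def G73 (M : Scheme k) : ℝ := M.avg fun w => w.w73
def G74 (M : Scheme k) : ℝ := M.avg fun w => w.w74
def G75t (M : Scheme k) : ℝ := M.avg fun w => w.w31 * w.w41

/-- The conditions for order six: every term of the error expansion up to `h ^ 6` vanishes. -/
def OrderSixConditions (M : Scheme k) : Prop :=
  M.G00 = 1 ∧ M.G31 = 0 ∧ M.G41 = 0 ∧ M.G51 = 0 ∧ M.G52 = 0 ∧
    M.G61 = 0 ∧ M.G62 = 0 ∧ M.G63t = 0

/-- All terms of the error expansion at `h ^ 7` vanish, except possibly that of `E73`. -/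
def OrderSevenTermsVanishExceptG73 (M : Scheme k) : Prop :=
  M.G71 = 0 ∧ M.G72 = 0 ∧ M.G74 = 0 ∧ M.G75t = 0

/-- The series of operators of the linear combination. -/
def series (M : Scheme k) : OpSeries := ∑ i, M.b i • stageSeries (M.a₁ i) (M.a₂ i)

/-- Order `p` in the sense of formal series of operators. -/
def HasFormalOrder (M : Scheme k) (p : ℕ) : Prop :=
  ∀ n ≤ p, PowerSeries.coeff n M.series = PowerSeries.coeff n (flowSeries 1)

/-- One step of size `h` of the linear combination, applied to `x`, for the basic map `S`. -/
def step (M : Scheme k) {d : ℕ} (S : ℝ → EuclideanSpace ℝ (Fin d) → EuclideanSpace ℝ (Fin d))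
    (h : ℝ) (x : EuclideanSpace ℝ (Fin d)) : EuclideanSpace ℝ (Fin d) :=
  ∑ i, M.b i • S (M.a₁ i * h) (S (M.a₂ i * h) (S ((1 - M.a₁ i - M.a₂ i) * h) x))

end Scheme

/-! ### Order of an integrator -/

/-- `x` solves `x' = f(x)` on a neighbourhood of `t = 0`. -/
def IsLocalSolution {d : ℕ} (f : EuclideanSpace ℝ (Fin d) → EuclideanSpace ℝ (Fin d))
    (x : ℝ → EuclideanSpace ℝ (Fin d)) : Prop :=
  ∀ᶠ t in 𝓝 (0 : ℝ), HasDerivAt x (f (x t)) t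

/-- The one-step map `Φ` has order `p` for `x' = f(x)`: `Φ_h(x₀) = φ_h(x₀) + O(h ^ (p+1))` for every
initial value `x₀`, where `φ` is the flow. -/
def OneStepOrder {d : ℕ} (f : EuclideanSpace ℝ (Fin d) → EuclideanSpace ℝ (Fin d))
    (Φ : ℝ → EuclideanSpace ℝ (Fin d) → EuclideanSpace ℝ (Fin d)) (p : ℕ) : Prop :=
  ∀ x : ℝ → EuclideanSpace ℝ (Fin d), IsLocalSolution f x →
    (fun h : ℝ => Φ h (x 0) - x h) =O[𝓝 0] fun h : ℝ => h ^ (p + 1)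

/-- `S` is a smooth time-symmetric integrator of second order for `x' = f(x)`. -/
structure IsBasicScheme {d : ℕ} (f : EuclideanSpace ℝ (Fin d) → EuclideanSpace ℝ (Fin d))
    (S : ℝ → EuclideanSpace ℝ (Fin d) → EuclideanSpace ℝ (Fin d)) : Prop where
  smooth : ContDiff ℝ ∞ fun p : ℝ × EuclideanSpace ℝ (Fin d) => S p.1 p.2
  symm : ∀ (h : ℝ) (x : EuclideanSpace ℝ (Fin d)), S (-h) (S h x) = x
  order_two : OneStepOrder f S 2

/-- The linear combination has order `p` for every smooth differential equation and every smooth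
time-symmetric basic integrator of second order. -/
def Scheme.HasOrder {k : ℕ} (M : Scheme k) (p : ℕ) : Prop :=
  ∀ (d : ℕ) (f : EuclideanSpace ℝ (Fin d) → EuclideanSpace ℝ (Fin d))
    (S : ℝ → EuclideanSpace ℝ (Fin d) → EuclideanSpace ℝ (Fin d)),
    ContDiff ℝ ∞ f → IsBasicScheme f S → OneStepOrder f (M.step S) p

end GenExtrap

end

/-!
A composition `S_{a₁ h} ∘ S_{a₂ h} ∘ S_{(1 - a₁ - a₂) h}` is compared with the flow by conjugation.
Each basic step is `exp (h Y₁ / 2)` times a symmetric error factor times `exp (h Y₁ / 2)`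
(`coeff_centredStep`); moving the exponentials of `Y₁` to both ends conjugates the error factors by
the flow, which amounts to iterated brackets with `Y₁` (`coeff_flowSeries_conj`). The relative
series of the composition is then a product of three series of the form `exp (h ^ 3 W)`, the
coefficients of which multiply by the Baker-Campbell-Hausdorff formula (`HasExpansion.mul`). This
gives the error coefficients as explicit polynomials in `a₁` and `a₂` (`stageCoeffs`,
`isErrorCoeffs_iff`); their uniqueness is the linear independence of the basis in each degree. The
linear relation between them is a polynomial identity (`stageCoeffs_relation`).

A linear combination of formal order seven would annihilate every term of the relation except the
constant, whence the formal barrier. For integrators the obstruction is visible on the linear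
chain `x_{i+1}' = x_i` of length eight, with the Strang splitting that alternates the odd and the
even links as basic scheme: transport from `x₀` to `x₇` takes four full steps, while a three-stage
composition has only three, so that `h ^ 7 / 7!` is missed (`Scheme.not_hasOrder_seven`).

The conditions on a combination of four compositions are twelve polynomial equations in twelve
unknowns. A real solution is obtained from a rational approximate one by a Newton-Kantorovich
argument (`exists_zero_of_approximate_inverse`): the equations, multiplied by an approximate inverse
of their derivative, are close to the identity on a small box, where the derivative is enclosed by
interval arithmetic over `ℚ`.
-/

namespace GenExtrap

open PowerSeries Finset

/-! ### Series modulo a power of the step size -/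

/-- `A` and `B` agree up to and including the term in `h ^ N`. -/
def EqUpTo (N : ℕ) (A B : OpSeries) : Prop := ∀ n ≤ N, coeff n A = coeff n B

theorem EqUpTo.mul {N : ℕ} {A A' B B' : OpSeries} (hA : EqUpTo N A A') (hB : EqUpTo N B B') :
    EqUpTo N (A * B) (A' * B') := by
  intro n hn
  rw [coeff_mul, coeff_mul]
  refine Finset.sum_congr rfl fun p hp => ?_
  have := mem_antidiagonal.1 hp
  rw [hA p.1 (by omega), hB p.2 (by omega)]

theorem EqUpTo.pow {N : ℕ} {A B : OpSeries} (h : EqUpTo N A B) (m : ℕ) :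
    EqUpTo N (A ^ m) (B ^ m) := by
  induction m with
  | zero => intro n _; simp
  | succ m ih => rw [pow_succ, pow_succ]; exact ih.mul h

theorem EqUpTo.refl (N : ℕ) (A : OpSeries) : EqUpTo N A A := fun _ _ => rfl

/-- `P` arises from `Q` by replacing `h` by `c h`. -/
def IsRescaled (c : ℝ) (P Q : OpSeries) : Prop := ∀ n, coeff n P = c ^ n • coeff n Q

theorem IsRescaled.mul {c : ℝ} {P P' Q Q' : OpSeries} (h : IsRescaled c P Q)
    (h' : IsRescaled c P' Q') : IsRescaled c (P * P') (Q * Q') := by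
  intro n
  rw [coeff_mul, coeff_mul, Finset.smul_sum]
  refine Finset.sum_congr rfl fun p hp => ?_
  rw [h, h', smul_mul_smul_comm, ← pow_add, mem_antidiagonal.1 hp]

theorem IsRescaled.pow {c : ℝ} {P Q : OpSeries} (h : IsRescaled c P Q) (m : ℕ) :
    IsRescaled c (P ^ m) (Q ^ m) := by
  induction m with
  | zero =>
    intro n
    rcases eq_or_ne n 0 with rfl | hn
    · simp
    · simp [coeff_one, hn]
  | succ m ih => rw [pow_succ, pow_succ]; exact ih.mul h

theorem IsRescaled.sexp {c : ℝ} {P Q : OpSeries} (h : IsRescaled c P Q) :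
    IsRescaled c (sexp P) (sexp Q) := by
  intro n
  simp only [GenExtrap.sexp, coeff_mk, Finset.smul_sum]
  refine Finset.sum_congr rfl fun m _ => ?_
  rw [h.pow m n, smul_comm]

/-! ### The series of the flow -/

theorem monomial_one_pow (a : OpAlg) (m : ℕ) :
    (monomial 1 a : OpSeries) ^ m = monomial m (a ^ m) := by
  induction m with
  | zero => simp
  | succ m ih => rw [pow_succ, ih, monomial_mul_monomial, pow_succ]

theorem coeff_flowSeries (c : ℝ) (n : ℕ) :
    coeff n (flowSeries c) = (c ^ n / n.factorial) • letter 0 ^ n := by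
  rw [flowSeries, sexp, coeff_mk, Finset.sum_eq_single n]
  · rw [monomial_one_pow, coeff_monomial_same, smul_pow, smul_smul, inv_mul_eq_div]
  · intro m _ hm
    rw [monomial_one_pow, coeff_monomial, if_neg hm.symm, smul_zero]
  · intro h
    simp at h

theorem flowSeries_mul (a b : ℝ) : flowSeries a * flowSeries b = flowSeries (a + b) := by
  ext1 n
  rw [coeff_mul, coeff_flowSeries, (Commute.all a b).add_pow', Finset.sum_div, Finset.sum_smul]
  refine Finset.sum_congr rfl fun p hp => ?_
  obtain ⟨i, j⟩ := p
  obtain rfl := mem_antidiagonal.1 hp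
  rw [coeff_flowSeries, coeff_flowSeries, smul_mul_smul_comm, ← pow_add]
  congr 1
  have h : ((i + j).choose i : ℝ) * i.factorial * j.factorial = (i + j).factorial := by
    rw [Nat.choose_symm_add]
    exact_mod_cast Nat.add_choose_mul_factorial_mul_factorial i j
  have hi : (i.factorial : ℝ) ≠ 0 := by positivity
  have hj : (j.factorial : ℝ) ≠ 0 := by positivity
  have hij : ((i + j).factorial : ℝ) ≠ 0 := by positivity
  rw [nsmul_eq_mul]
  field_simp
  rw [← h]
  ring

theorem flowSeries_zero : flowSeries 0 = 1 := by
  ext1 n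
  rw [coeff_flowSeries, coeff_one]
  rcases eq_or_ne n 0 with rfl | hn
  · simp
  · simp [hn]

theorem flowSeries_neg_mul (a : ℝ) : flowSeries (-a) * flowSeries a = 1 := by
  rw [flowSeries_mul, neg_add_cancel, flowSeries_zero]

theorem flowSeries_mul_neg (a : ℝ) : flowSeries a * flowSeries (-a) = 1 := by
  rw [flowSeries_mul, add_neg_cancel, flowSeries_zero]

theorem isRescaled_flowSeries (c a : ℝ) : IsRescaled c (flowSeries (c * a)) (flowSeries a) := by
  intro n
  rw [coeff_flowSeries, coeff_flowSeries, smul_smul, mul_pow, mul_div_assoc]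

theorem isRescaled_baseLog (c : ℝ) : IsRescaled c (baseLog c) (baseLog 1) := by
  intro n
  simp only [baseLog, coeff_mk]
  split_ifs <;> simp

/-! ### Logarithms of series `1 + O(h ^ 3)` -/

theorem coeff_X_pow_three_mul_pow (W : OpSeries) (m n : ℕ) :
    coeff n ((X ^ 3 * W) ^ m) = if 3 * m ≤ n then coeff (n - 3 * m) (W ^ m) else 0 := by
  rw [((commute_X_pow W 3).symm).mul_pow, ← pow_mul, coeff_X_pow_mul']

/-- In the coefficient of `h ^ (n + 3)` of `exp (h ^ 3 W)`, the coefficient of `h ^ n` of `W` enters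
linearly, and all others that enter are those of lower powers of `h`. -/
theorem coeff_add_three_sexp (W W' : OpSeries) (n : ℕ) (h : ∀ k < n, coeff k W = coeff k W') :
    coeff (n + 3) (sexp (X ^ 3 * W)) - coeff n W =
      coeff (n + 3) (sexp (X ^ 3 * W')) - coeff n W' := by
  have key : ∀ V : OpSeries, coeff (n + 3) (sexp (X ^ 3 * V)) - coeff n V =
      ∑ m ∈ range (n + 2), (((m + 2).factorial : ℝ)⁻¹) • coeff (n + 3) ((X ^ 3 * V) ^ (m + 2)) := by
    intro V
    rw [sexp, coeff_mk, Finset.sum_range_succ', Finset.sum_range_succ']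
    simp only [coeff_X_pow_three_mul_pow]
    simp [coeff_one]
  rw [key, key]
  refine Finset.sum_congr rfl fun m _ => ?_
  rw [coeff_X_pow_three_mul_pow, coeff_X_pow_three_mul_pow]
  split_ifs with hm
  · have : EqUpTo (n + 3 - 3 * (m + 2)) W W' := fun k hk => h k (by omega)
    rw [this.pow (m + 2) _ le_rfl]
  · rfl

/-- The coefficients of the series `W` with `exp (h ^ 3 W) = R`. -/
noncomputable def logCoeff (R : OpSeries) (n : ℕ) : OpAlg :=
  coeff (n + 3) R -
    coeff (n + 3) (sexp (X ^ 3 * PowerSeries.mk fun k => if _ : k < n then logCoeff R k else 0))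

/-- Every series `1 + O(h ^ 3)` has a logarithm. -/
theorem exists_sexp_eq (R : OpSeries) (h0 : coeff 0 R = 1) (h1 : coeff 1 R = 0)
    (h2 : coeff 2 R = 0) : ∃ W : OpSeries, sexp (X ^ 3 * W) = R := by
  refine ⟨PowerSeries.mk (logCoeff R), ?_⟩
  ext1 n
  match n with
  | 0 => simp [sexp, h0]
  | 1 => simp [sexp, coeff_X_pow_three_mul_pow, Finset.sum_range_succ, h1, coeff_one]
  | 2 => simp [sexp, coeff_X_pow_three_mul_pow, Finset.sum_range_succ, h2, coeff_one]
  | n + 3 =>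
    have := coeff_add_three_sexp (PowerSeries.mk (logCoeff R))
      (PowerSeries.mk fun k => if _ : k < n then logCoeff R k else 0) n
      (fun k hk => by simp [hk])
    rw [coeff_mk, coeff_mk, dif_neg (lt_irrefl n), sub_zero, logCoeff.eq_def R n] at this
    rw [sub_eq_iff_eq_add] at this
    rw [this]
    abel

/-- The coefficients of `exp (h ^ 3 W)` up to `h ^ 7`. -/
theorem coeff_sexp_X_pow_three_mul (W : OpSeries) :
    coeff 3 (sexp (X ^ 3 * W)) = coeff 0 W ∧
    coeff 4 (sexp (X ^ 3 * W)) = coeff 1 W ∧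
    coeff 5 (sexp (X ^ 3 * W)) = coeff 2 W ∧
    coeff 6 (sexp (X ^ 3 * W)) = coeff 3 W + (1 / 2 : ℝ) • (coeff 0 W * coeff 0 W) ∧
    coeff 7 (sexp (X ^ 3 * W)) =
      coeff 4 W + (1 / 2 : ℝ) • (coeff 0 W * coeff 1 W + coeff 1 W * coeff 0 W) := by
  simp only [sexp, coeff_mk, coeff_X_pow_three_mul_pow, Finset.sum_range_succ]
  norm_num [coeff_one, pow_two, coeff_mul, Finset.Nat.sum_antidiagonal_eq_sum_range_succ_mk,
    Finset.sum_range_succ]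

/-! ### The symmetric conjugate of one basic step -/

theorem coeff_baseLog_one (n : ℕ) :
    coeff n (baseLog 1) = if Odd n then letter (n / 2) else 0 := by
  simp [baseLog]

/-- Multiplication by `Y(h)`, up to `h ^ 7`. -/
theorem coeff_baseLog_mul (Q : OpSeries) :
    coeff 0 (baseLog 1 * Q) = 0 ∧
    coeff 1 (baseLog 1 * Q) = letter 0 * coeff 0 Q ∧
    coeff 2 (baseLog 1 * Q) = letter 0 * coeff 1 Q ∧
    coeff 3 (baseLog 1 * Q) = letter 0 * coeff 2 Q + letter 1 * coeff 0 Q ∧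
    coeff 4 (baseLog 1 * Q) = letter 0 * coeff 3 Q + letter 1 * coeff 1 Q ∧
    coeff 5 (baseLog 1 * Q) =
      letter 0 * coeff 4 Q + letter 1 * coeff 2 Q + letter 2 * coeff 0 Q ∧
    coeff 6 (baseLog 1 * Q) =
      letter 0 * coeff 5 Q + letter 1 * coeff 3 Q + letter 2 * coeff 1 Q ∧
    coeff 7 (baseLog 1 * Q) =
      letter 0 * coeff 6 Q + letter 1 * coeff 4 Q + letter 2 * coeff 2 Q
        + letter 3 * coeff 0 Q := by
  have o1 : Odd 1 := by decide
  have o3 : Odd 3 := by decide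
  have o5 : Odd 5 := by decide
  have o7 : Odd 7 := by decide
  have e0 : ¬ Odd 0 := by decide
  have e2 : ¬ Odd 2 := by decide
  have e4 : ¬ Odd 4 := by decide
  have e6 : ¬ Odd 6 := by decide
  simp only [coeff_mul, Finset.Nat.sum_antidiagonal_eq_sum_range_succ_mk, Finset.sum_range_succ,
    coeff_baseLog_one, Nat.succ_eq_add_one, Finset.sum_range_zero, o1, o3, o5, o7, e0, e2, e4, e6,
    if_true, if_false, zero_mul, zero_add, add_zero, Nat.reduceAdd, Nat.reduceSub, Nat.reduceDiv,
    Nat.sub_zero, and_self]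

/-- The series of a basic step, up to `h ^ 7`. -/
theorem coeff_sexp_baseLog_one :
    coeff 0 (sexp (baseLog 1)) = 1 ∧
    coeff 1 (sexp (baseLog 1)) =
      letter 0 ∧
    coeff 2 (sexp (baseLog 1)) =
      (1 / 2 : ℝ) • letter 0 ^ 2 ∧
    coeff 3 (sexp (baseLog 1)) =
      (1 / 6 : ℝ) • letter 0 ^ 3 + letter 1 ∧
    coeff 4 (sexp (baseLog 1)) =
      (1 / 24 : ℝ) • letter 0 ^ 4 + (1 / 2 : ℝ) • (letter 0 * letter 1)
          + (1 / 2 : ℝ) • (letter 1 * letter 0) ∧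
    coeff 5 (sexp (baseLog 1)) =
      (1 / 120 : ℝ) • letter 0 ^ 5 + (1 / 6 : ℝ) • (letter 0 ^ 2 * letter 1)
          + (1 / 6 : ℝ) • (letter 0 * letter 1 * letter 0)
          + (1 / 6 : ℝ) • (letter 1 * letter 0 ^ 2) + letter 2 ∧
    coeff 6 (sexp (baseLog 1)) =
      (1 / 720 : ℝ) • letter 0 ^ 6 + (1 / 24 : ℝ) • (letter 0 ^ 3 * letter 1)
          + (1 / 24 : ℝ) • (letter 0 ^ 2 * letter 1 * letter 0)
          + (1 / 24 : ℝ) • (letter 0 * letter 1 * letter 0 ^ 2)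
          + (1 / 2 : ℝ) • (letter 0 * letter 2) + (1 / 24 : ℝ) • (letter 1 * letter 0 ^ 3)
          + (1 / 2 : ℝ) • letter 1 ^ 2 + (1 / 2 : ℝ) • (letter 2 * letter 0) ∧
    coeff 7 (sexp (baseLog 1)) =
      (1 / 5040 : ℝ) • letter 0 ^ 7 + (1 / 120 : ℝ) • (letter 0 ^ 4 * letter 1)
          + (1 / 120 : ℝ) • (letter 0 ^ 3 * letter 1 * letter 0)
          + (1 / 120 : ℝ) • (letter 0 ^ 2 * letter 1 * letter 0 ^ 2)
          + (1 / 6 : ℝ) • (letter 0 ^ 2 * letter 2)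
          + (1 / 120 : ℝ) • (letter 0 * letter 1 * letter 0 ^ 3)
          + (1 / 6 : ℝ) • (letter 0 * letter 1 ^ 2)
          + (1 / 6 : ℝ) • (letter 0 * letter 2 * letter 0)
          + (1 / 120 : ℝ) • (letter 1 * letter 0 ^ 4)
          + (1 / 6 : ℝ) • (letter 1 * letter 0 * letter 1)
          + (1 / 6 : ℝ) • (letter 1 ^ 2 * letter 0) + (1 / 6 : ℝ) • (letter 2 * letter 0 ^ 2)
          + letter 3 := by
  refine ⟨?_, ?_, ?_, ?_, ?_, ?_, ?_, ?_⟩ <;>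
  · simp only [sexp, coeff_mk, Finset.sum_range_succ, pow_succ', pow_zero, coeff_baseLog_mul,
      Finset.sum_range_zero, coeff_one, Nat.factorial, OfNat.ofNat_ne_zero, one_ne_zero,
      if_false, mul_zero, zero_add, add_zero, smul_zero, mul_add, smul_add, mul_assoc]
    norm_num
    try module

/-- The series `exp (-h Y₁ / 2) * exp (Y(h)) * exp (-h Y₁ / 2)` of a basic step, relative to the
flow. -/
noncomputable def centredStep : OpSeries :=
  flowSeries (-(1 / 2)) * sexp (baseLog 1) * flowSeries (-(1 / 2))

theorem coeff_centredStep :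
    coeff 0 centredStep = 1 ∧ coeff 1 centredStep = 0 ∧ coeff 2 centredStep = 0 ∧
    coeff 3 centredStep = E31 ∧ coeff 4 centredStep = 0 ∧
    coeff 5 centredStep = E51 + (1 / 24 : ℝ) • E52 ∧
    coeff 6 centredStep = (1 / 2 : ℝ) • (E31 * E31) ∧
    coeff 7 centredStep = E71 + (1 / 24 : ℝ) • E72 + (1 / 1920 : ℝ) • E73 + (1 / 12 : ℝ) • E74 := by
  obtain ⟨u0, u1, u2, u3, u4, u5, u6, u7⟩ := coeff_sexp_baseLog_one
  refine ⟨?_, ?_, ?_, ?_, ?_, ?_, ?_, ?_⟩ <;>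
  · simp only [centredStep, coeff_mul, Finset.Nat.sum_antidiagonal_eq_sum_range_succ_mk,
      Finset.sum_range_succ, Finset.sum_range_zero, coeff_flowSeries, u0, u1, u2, u3, u4, u5, u6,
      u7, Nat.reduceAdd, Nat.reduceSub, Nat.succ_eq_add_one, pow_succ', pow_zero, mul_one, mul_zero,
      zero_add, Nat.sub_zero, E31, E51, E52, E41, E71, E72, E61, E73, E62, E74, Ring.lie_def,
      mul_add, add_mul, mul_sub, sub_mul, smul_mul_assoc, mul_smul_comm, mul_assoc, one_mul,
      Nat.sub_self, Nat.factorial]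
    module

/-- Conjugation by the flow acts through the iterated brackets with `Y₁`. -/
theorem coeff_flowSeries_conj (s : ℝ) (A : OpSeries) (h0 : coeff 0 A = 1) (h1 : coeff 1 A = 0)
    (h2 : coeff 2 A = 0) (h4 : coeff 4 A = 0) :
    coeff 0 (flowSeries s * A * flowSeries (-s)) = 1 ∧
    coeff 1 (flowSeries s * A * flowSeries (-s)) = 0 ∧
    coeff 2 (flowSeries s * A * flowSeries (-s)) = 0 ∧
    coeff 3 (flowSeries s * A * flowSeries (-s)) = coeff 3 A ∧
    coeff 4 (flowSeries s * A * flowSeries (-s)) = s • ⁅letter 0, coeff 3 A⁆ ∧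
    coeff 5 (flowSeries s * A * flowSeries (-s)) =
      coeff 5 A + (s ^ 2 / 2) • ⁅letter 0, ⁅letter 0, coeff 3 A⁆⁆ ∧
    coeff 6 (flowSeries s * A * flowSeries (-s)) =
      coeff 6 A + s • ⁅letter 0, coeff 5 A⁆
        + (s ^ 3 / 6) • ⁅letter 0, ⁅letter 0, ⁅letter 0, coeff 3 A⁆⁆⁆ ∧
    coeff 7 (flowSeries s * A * flowSeries (-s)) =
      coeff 7 A + s • ⁅letter 0, coeff 6 A⁆ + (s ^ 2 / 2) • ⁅letter 0, ⁅letter 0, coeff 5 A⁆⁆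
        + (s ^ 4 / 24) • ⁅letter 0, ⁅letter 0, ⁅letter 0, ⁅letter 0, coeff 3 A⁆⁆⁆⁆ := by
  refine ⟨?_, ?_, ?_, ?_, ?_, ?_, ?_, ?_⟩ <;>
  · simp only [coeff_mul, Finset.Nat.sum_antidiagonal_eq_sum_range_succ_mk,
      Finset.sum_range_succ, Finset.sum_range_zero, coeff_flowSeries, h0, h1, h2, h4,
      Nat.reduceAdd, Nat.reduceSub, Nat.succ_eq_add_one, pow_succ', pow_zero, mul_one, mul_zero,
      zero_mul, zero_add, Nat.sub_zero, Ring.lie_def,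
      mul_add, mul_sub, sub_mul, smul_mul_assoc, mul_smul_comm, mul_assoc, one_mul,
      Nat.sub_self, Nat.factorial]
    module

/-! ### Linear independence of the basis -/

/-- The product of the letters of a word. -/
noncomputable def word (l : List ℕ) : OpAlg := (l.map letter).prod

theorem letter_eq_word (k : ℕ) : letter k = word [k] := by simp [word]

theorem word_mul (l l' : List ℕ) : word l * word l' = word (l ++ l') := by simp [word]

/-- The coefficient of a word in an element of the free algebra. -/
noncomputable def wordCoeff (l : List ℕ) : OpAlg →ₗ[ℝ] ℝ where
  toFun P := (FreeAlgebra.equivMonoidAlgebraFreeMonoid P).coeff (FreeMonoid.ofList l)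
  map_add' P Q := by rw [map_add, MonoidAlgebra.coeff_add, Finsupp.add_apply]
  map_smul' r P := by
    rw [map_smul, MonoidAlgebra.coeff_smul, Finsupp.smul_apply, RingHom.id_apply]

theorem equivMonoidAlgebraFreeMonoid_word (l : List ℕ) :
    FreeAlgebra.equivMonoidAlgebraFreeMonoid (word l) =
      MonoidAlgebra.single (FreeMonoid.ofList l) (1 : ℝ) := by
  induction l with
  | nil => rw [word, List.map_nil, List.prod_nil, map_one]; rfl
  | cons k l ih =>
    have : FreeAlgebra.equivMonoidAlgebraFreeMonoid (letter k) =
        MonoidAlgebra.single (FreeMonoid.of k) (1 : ℝ) := by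
      simp [letter, FreeAlgebra.equivMonoidAlgebraFreeMonoid]
    rw [word, List.map_cons, List.prod_cons, map_mul, ← word, ih, this,
      MonoidAlgebra.single_mul_single, one_mul]
    rfl

theorem wordCoeff_word (l l' : List ℕ) : wordCoeff l (word l') = if l' = l then 1 else 0 := by
  simp only [wordCoeff, LinearMap.coe_mk, AddHom.coe_mk, equivMonoidAlgebraFreeMonoid_word]
  rw [MonoidAlgebra.coeff_single]
  split_ifs with h
  · rw [h, Finsupp.single_eq_same]
  · exact Finsupp.single_eq_of_ne fun h' => h (FreeMonoid.ofList.injective h').symm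

theorem eq_zero_of_smul_E31 {a : ℝ} (h : a • E31 = 0) : a = 0 := by
  have := congrArg (wordCoeff [1]) h
  simpa [E31, letter_eq_word, wordCoeff_word] using this

theorem eq_zero_of_smul_E41 {a : ℝ} (h : a • E41 = 0) : a = 0 := by
  have := congrArg (wordCoeff [0, 1]) h
  simpa [E41, E31, Ring.lie_def, letter_eq_word, word_mul, wordCoeff_word] using this

theorem eq_zero_of_degree_five {a b : ℝ} (h : a • E51 + b • E52 = 0) : a = 0 ∧ b = 0 := by
  have h1 := congrArg (wordCoeff [2]) h
  have h2 := congrArg (wordCoeff [0, 0, 1]) h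
  simp [E51, E52, E41, E31, Ring.lie_def, letter_eq_word, word_mul, mul_sub, sub_mul,
    wordCoeff_word] at h1 h2
  exact ⟨h1, h2⟩

theorem eq_zero_of_degree_six {a b c : ℝ} (h : a • E61 + b • E62 + c • (E31 * E31) = 0) :
    a = 0 ∧ b = 0 ∧ c = 0 := by
  have h1 := congrArg (wordCoeff [0, 2]) h
  have h2 := congrArg (wordCoeff [0, 0, 0, 1]) h
  have h3 := congrArg (wordCoeff [1, 1]) h
  simp [E61, E62, E51, E52, E41, E31, Ring.lie_def, letter_eq_word, word_mul, mul_sub, sub_mul,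
    wordCoeff_word] at h1 h2 h3
  exact ⟨h1, h2, h3⟩

theorem eq_zero_of_degree_seven {a b c d e : ℝ}
    (h : a • E71 + b • E72 + c • E73 + d • E74 + e • (E31 * E41 + E41 * E31) = 0) :
    a = 0 ∧ b = 0 ∧ c = 0 ∧ d = 0 ∧ e = 0 := by
  have h1 := congrArg (wordCoeff [3]) h
  have h2 := congrArg (wordCoeff [0, 0, 2]) h
  have h3 := congrArg (wordCoeff [0, 0, 0, 0, 1]) h
  have h4 := congrArg (wordCoeff [1, 0, 1]) h
  have h5 := congrArg (wordCoeff [0, 1, 1]) h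
  simp [E71, E72, E73, E74, E61, E62, E51, E52, E41, E31, Ring.lie_def, letter_eq_word, word_mul,
    mul_sub, sub_mul, wordCoeff_word] at h1 h2 h3 h4 h5
  exact ⟨h1, h2, h3, by linarith, by linarith⟩

/-! ### Series of the form `exp (h ^ 3 W)` -/

/-- Up to `h ^ 7`, the series `A` is `exp (h ^ 3 W)` for a Lie series `W` with the coefficients `w`:
`h ^ 6` and `h ^ 7` also carry the terms of `W ^ 2 / 2`. -/
def HasExpansion (w : ErrorCoeffs) (A : OpSeries) : Prop :=
  coeff 0 A = 1 ∧ coeff 1 A = 0 ∧ coeff 2 A = 0 ∧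
  coeff 3 A = w.w31 • E31 ∧
  coeff 4 A = w.w41 • E41 ∧
  coeff 5 A = w.w51 • E51 + w.w52 • E52 ∧
  coeff 6 A = w.w61 • E61 + w.w62 • E62 + (w.w31 ^ 2 / 2) • (E31 * E31) ∧
  coeff 7 A = w.w71 • E71 + w.w72 • E72 + w.w73 • E73 + w.w74 • E74
    + (w.w31 * w.w41 / 2) • (E31 * E41 + E41 * E31)

theorem HasExpansion.unique {w w' : ErrorCoeffs} {A : OpSeries} (h : HasExpansion w A)
    (h' : HasExpansion w' A) : w = w' := by
  obtain ⟨-, -, -, h3, h4, h5, h6, h7⟩ := h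
  obtain ⟨-, -, -, h3', h4', h5', h6', h7'⟩ := h'
  have e3 := eq_zero_of_smul_E31 (a := w.w31 - w'.w31) (by rw [sub_smul, ← h3, ← h3', sub_self])
  have e4 := eq_zero_of_smul_E41 (a := w.w41 - w'.w41) (by rw [sub_smul, ← h4, ← h4', sub_self])
  have e5 := eq_zero_of_degree_five (a := w.w51 - w'.w51) (b := w.w52 - w'.w52)
    (by
      have := sub_eq_zero.2 (h5.symm.trans h5')
      rw [← this]
      module)
  have e6 := eq_zero_of_degree_six (a := w.w61 - w'.w61) (b := w.w62 - w'.w62)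
    (c := w.w31 ^ 2 / 2 - w'.w31 ^ 2 / 2) (by
      have := sub_eq_zero.2 (h6.symm.trans h6')
      rw [← this]
      module)
  have e7 := eq_zero_of_degree_seven (a := w.w71 - w'.w71) (b := w.w72 - w'.w72)
    (c := w.w73 - w'.w73) (d := w.w74 - w'.w74)
    (e := w.w31 * w.w41 / 2 - w'.w31 * w'.w41 / 2) (by
      have := sub_eq_zero.2 (h7.symm.trans h7')
      rw [← this]
      module)
  ext <;> linarith [e5.1, e5.2, e6.1, e6.2.1, e7.1, e7.2.1, e7.2.2.1, e7.2.2.2.1]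

/-- The coefficients of the product of two series of the form `exp (h ^ 3 W)`. By the
Baker-Campbell-Hausdorff formula, the logarithms add up but for their first bracket, a multiple of
`E74`. -/
noncomputable def ErrorCoeffs.comp (w w' : ErrorCoeffs) : ErrorCoeffs where
  w31 := w.w31 + w'.w31
  w41 := w.w41 + w'.w41
  w51 := w.w51 + w'.w51
  w52 := w.w52 + w'.w52
  w61 := w.w61 + w'.w61
  w62 := w.w62 + w'.w62
  w71 := w.w71 + w'.w71
  w72 := w.w72 + w'.w72
  w73 := w.w73 + w'.w73
  w74 := w.w74 + w'.w74 + (w.w31 * w'.w41 - w'.w31 * w.w41) / 2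

theorem HasExpansion.mul {w w' : ErrorCoeffs} {A B : OpSeries} (hA : HasExpansion w A)
    (hB : HasExpansion w' B) : HasExpansion (w.comp w') (A * B) := by
  obtain ⟨a0, a1, a2, a3, a4, a5, a6, a7⟩ := hA
  obtain ⟨b0, b1, b2, b3, b4, b5, b6, b7⟩ := hB
  refine ⟨?_, ?_, ?_, ?_, ?_, ?_, ?_, ?_⟩ <;>
  · simp only [coeff_mul, Finset.Nat.sum_antidiagonal_eq_sum_range_succ_mk,
      Finset.sum_range_succ, Finset.sum_range_zero, a0, a1, a2, a3, a4, a5, a6, a7,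
      b0, b1, b2, b3, b4, b5, b6, b7, ErrorCoeffs.comp, E74, Ring.lie_def E31 E41,
      Nat.reduceAdd, Nat.reduceSub, Nat.succ_eq_add_one, mul_one, mul_zero,
      zero_mul, zero_add, add_zero, Nat.sub_zero, smul_mul_assoc, mul_smul_comm, one_mul,
      Nat.sub_self]
    try module

/-! ### The error coefficients of a composition -/

/-- The series of a basic step of size `c h`, relative to the flow, and conjugated by the flow with
step `s h`. -/
noncomputable def stepFactor (c s : ℝ) : OpSeries :=
  flowSeries (s - c / 2) * sexp (baseLog c) * flowSeries (-s - c / 2)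

/-- The error coefficients of `stepFactor c s`. -/
noncomputable def stepCoeffs (c s : ℝ) : ErrorCoeffs where
  w31 := c ^ 3
  w41 := c ^ 3 * s
  w51 := c ^ 5
  w52 := c ^ 5 / 24 + c ^ 3 * s ^ 2 / 2
  w61 := c ^ 5 * s
  w62 := c ^ 5 * s / 24 + c ^ 3 * s ^ 3 / 6
  w71 := c ^ 7
  w72 := c ^ 7 / 24 + c ^ 5 * s ^ 2 / 2
  w73 := c ^ 7 / 1920 + c ^ 5 * s ^ 2 / 48 + c ^ 3 * s ^ 4 / 24
  w74 := c ^ 7 / 12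

theorem bracket_smul (P : OpAlg) (r : ℝ) (Q : OpAlg) : ⁅P, r • Q⁆ = r • ⁅P, Q⁆ := by
  rw [Ring.lie_def, Ring.lie_def, mul_smul_comm, smul_mul_assoc, smul_sub]

theorem bracket_add (P Q R : OpAlg) : ⁅P, Q + R⁆ = ⁅P, Q⁆ + ⁅P, R⁆ := by
  simp only [Ring.lie_def, mul_add, add_mul]
  abel

theorem hasExpansion_stepFactor (c s : ℝ) : HasExpansion (stepCoeffs c s) (stepFactor c s) := by
  set V : OpSeries := flowSeries (-(c / 2)) * sexp (baseLog c) * flowSeries (-(c / 2)) with hV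
  have hS : stepFactor c s = flowSeries s * V * flowSeries (-s) := by
    have e1 : flowSeries (s - c / 2) = flowSeries s * flowSeries (-(c / 2)) := by
      rw [flowSeries_mul, sub_eq_add_neg]
    have e2 : flowSeries (-s - c / 2) = flowSeries (-(c / 2)) * flowSeries (-s) := by
      rw [flowSeries_mul, sub_eq_add_neg, add_comm]
    rw [stepFactor, e1, e2, hV]
    simp only [mul_assoc]
  have hr : IsRescaled c V centredStep := by
    have e : -(c / 2) = c * (-(1 / 2)) := by ring
    rw [hV, e]
    exact ((isRescaled_flowSeries c _).mul (isRescaled_baseLog c).sexp).mul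
      (isRescaled_flowSeries c _)
  obtain ⟨v0, v1, v2, v3, v4, v5, v6, v7⟩ := coeff_centredStep
  obtain ⟨r0, r1, r2, r3, r4, r5, r6, r7⟩ := coeff_flowSeries_conj s V
    (by rw [hr, v0, pow_zero, one_smul]) (by rw [hr, v1, smul_zero]) (by rw [hr, v2, smul_zero])
    (by rw [hr, v4, smul_zero])
  have bracket_square : ⁅letter 0, E31 * E31⁆ = E31 * E41 + E41 * E31 := by
    simp only [E41, Ring.lie_def]
    noncomm_ring
  rw [hr 3, v3] at r3
  rw [hr 3, v3, bracket_smul, ← E41] at r4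
  rw [hr 5, v5, hr 3, v3, bracket_smul, bracket_smul, ← E41, ← E52] at r5
  rw [hr 6, v6, hr 5, v5, hr 3, v3, bracket_smul, bracket_smul, bracket_smul, bracket_smul,
    bracket_add, bracket_smul,
    ← E41, ← E52, ← E62, ← E61] at r6
  rw [hr 7, v7, hr 6, v6, hr 5, v5, hr 3, v3] at r7
  simp only [bracket_smul, bracket_add, bracket_square] at r7
  rw [← E41, ← E52, ← E61, ← E62, ← E72, ← E73] at r7
  rw [hS]
  refine ⟨r0, r1, r2, ?_, ?_, ?_, ?_, ?_⟩
  · rw [r3, stepCoeffs]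
  · rw [r4, stepCoeffs]
    module
  · rw [r5, stepCoeffs]
    module
  · rw [r6, stepCoeffs]
    module
  · rw [r7, stepCoeffs]
    module

/-- The series of a three-stage composition relative to the flow. -/
noncomputable def centredStage (a₁ a₂ : ℝ) : OpSeries :=
  flowSeries (-(1 / 2)) * stageSeries a₁ a₂ * flowSeries (-(1 / 2))

theorem stageSeries_eq (a₁ a₂ : ℝ) :
    stageSeries a₁ a₂ = flowSeries (1 / 2) * centredStage a₁ a₂ * flowSeries (1 / 2) := by
  have h1 := flowSeries_mul_neg (1 / 2)
  have h2 := flowSeries_neg_mul (1 / 2)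
  calc stageSeries a₁ a₂
      = flowSeries (1 / 2) * flowSeries (-(1 / 2)) * stageSeries a₁ a₂ *
        (flowSeries (-(1 / 2)) * flowSeries (1 / 2)) := by rw [h1, h2, one_mul, mul_one]
    _ = _ := by simp only [centredStage, mul_assoc]

/-- The error coefficients of a three-stage composition. -/
noncomputable def stageCoeffs (a₁ a₂ : ℝ) : ErrorCoeffs :=
  ((stepCoeffs (1 - a₁ - a₂) (-(a₁ + a₂) / 2)).comp
    (stepCoeffs a₂ (1 / 2 - a₁ - a₂ / 2))).comp (stepCoeffs a₁ (1 / 2 - a₁ / 2))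

/-- The flows between consecutive factors cancel for the shifts `-(a₁ + a₂) / 2`,
`1 / 2 - a₁ - a₂ / 2` and `1 / 2 - a₁ / 2`, the midpoints of the three steps minus `1 / 2`. -/
theorem hasExpansion_centredStage (a₁ a₂ : ℝ) :
    HasExpansion (stageCoeffs a₁ a₂) (centredStage a₁ a₂) := by
  have h : centredStage a₁ a₂ = stepFactor (1 - a₁ - a₂) (-(a₁ + a₂) / 2) *
      stepFactor a₂ (1 / 2 - a₁ - a₂ / 2) * stepFactor a₁ (1 / 2 - a₁ / 2) := by
    have e1 : -(a₁ + a₂) / 2 - (1 - a₁ - a₂) / 2 = -(1 / 2) := by ring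
    have e2 : -(-(a₁ + a₂) / 2) - (1 - a₁ - a₂) / 2 = -(1 / 2 - a₁ - a₂ / 2 - a₂ / 2) := by ring
    have e3 : -(1 / 2 - a₁ - a₂ / 2) - a₂ / 2 = -(1 / 2 - a₁ / 2 - a₁ / 2) := by ring
    have e4 : -(1 / 2 - a₁ / 2) - a₁ / 2 = -(1 / 2) := by ring
    have h1 := flowSeries_neg_mul (1 / 2 - a₁ - a₂ / 2 - a₂ / 2)
    have h2 := flowSeries_neg_mul (1 / 2 - a₁ / 2 - a₁ / 2)
    simp only [stepFactor, e1, e2, e3, e4, centredStage, stageSeries]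
    simp only [mul_assoc]
    rw [← mul_assoc (flowSeries (-(1 / 2 - a₁ - a₂ / 2 - a₂ / 2))), h1, one_mul,
      ← mul_assoc (flowSeries (-(1 / 2 - a₁ / 2 - a₁ / 2))), h2, one_mul]
  rw [h]
  exact ((hasExpansion_stepFactor _ _).mul (hasExpansion_stepFactor _ _)).mul
    (hasExpansion_stepFactor _ _)

theorem isErrorCoeffs_iff (a₁ a₂ : ℝ) (w : ErrorCoeffs) :
    IsErrorCoeffs a₁ a₂ w ↔ w = stageCoeffs a₁ a₂ := by
  constructor
  · rintro ⟨W, hW, h0, h1, h2, h3, h4⟩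
    have hc : centredStage a₁ a₂ = sexp (X ^ 3 * W) := by
      have h1 := flowSeries_mul_neg (1 / 2)
      have h2 := flowSeries_neg_mul (1 / 2)
      calc centredStage a₁ a₂ = flowSeries (-(1 / 2)) * flowSeries (1 / 2) * sexp (X ^ 3 * W) *
            (flowSeries (1 / 2) * flowSeries (-(1 / 2))) := by
              simp only [centredStage, hW, mul_assoc]
        _ = _ := by rw [h1, h2, one_mul, mul_one]
    obtain ⟨c3, c4, c5, c6, c7⟩ := coeff_sexp_X_pow_three_mul W
    obtain ⟨d0, d1, d2, -⟩ := hasExpansion_centredStage a₁ a₂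
    refine HasExpansion.unique (A := centredStage a₁ a₂) ⟨d0, d1, d2, ?_, ?_, ?_, ?_, ?_⟩
      (hasExpansion_centredStage a₁ a₂)
    · rw [hc, c3, h0]
    · rw [hc, c4, h1]
    · rw [hc, c5, h2]
    · rw [hc, c6, h3, h0, smul_mul_smul_comm]
      module
    · rw [hc, c7, h4, h0, h1, smul_mul_smul_comm, smul_mul_smul_comm]
      module
  · rintro rfl
    obtain ⟨d0, d1, d2, d3, d4, d5, d6, d7⟩ := hasExpansion_centredStage a₁ a₂
    obtain ⟨W, hW⟩ := exists_sexp_eq _ d0 d1 d2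
    obtain ⟨c3, c4, c5, c6, c7⟩ := coeff_sexp_X_pow_three_mul W
    rw [hW] at c3 c4 c5 c6 c7
    have h0 := c3.symm.trans d3
    have h1 := c4.symm.trans d4
    refine ⟨W, by rw [hW, stageSeries_eq], h0, h1, c5.symm.trans d5, ?_, ?_⟩
    · have := c6.symm.trans d6
      rw [h0, smul_mul_smul_comm] at this
      rw [eq_sub_of_add_eq this]
      module
    · have := c7.symm.trans d7
      rw [h0, h1, smul_mul_smul_comm, smul_mul_smul_comm] at this
      rw [eq_sub_of_add_eq this]
      module

theorem existsUnique_isErrorCoeffs (a₁ a₂ : ℝ) : ∃! w, IsErrorCoeffs a₁ a₂ w :=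
  ⟨stageCoeffs a₁ a₂, (isErrorCoeffs_iff _ _ _).2 rfl, fun _ h => (isErrorCoeffs_iff _ _ _).1 h⟩

theorem errorCoeffs_eq (a₁ a₂ : ℝ) : errorCoeffs a₁ a₂ = stageCoeffs a₁ a₂ :=
  (isErrorCoeffs_iff _ _ _).1
    (Classical.epsilon_spec (p := IsErrorCoeffs a₁ a₂) (existsUnique_isErrorCoeffs a₁ a₂).exists)

/-- The linear relation between the error coefficients of every composition. -/
theorem stageCoeffs_relation (a₁ a₂ : ℝ) :
    35 / 4 * (stageCoeffs a₁ a₂).w31 - 63 / 2 * (stageCoeffs a₁ a₂).w51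
      + 35 * (stageCoeffs a₁ a₂).w31 ^ 2 + 36 * (stageCoeffs a₁ a₂).w71
      - 420 * (stageCoeffs a₁ a₂).w72 + 10080 * (stageCoeffs a₁ a₂).w73
      - 420 * (stageCoeffs a₁ a₂).w74 = 1 := by
  simp only [stageCoeffs, ErrorCoeffs.comp, stepCoeffs]
  ring

/-! ### Linear combinations and formal order -/

namespace Scheme

variable {k : ℕ}

/-- The series of the linear combination, relative to the flow. -/
noncomputable def centred (M : Scheme k) : OpSeries :=
  ∑ i, M.b i • centredStage (M.a₁ i) (M.a₂ i)

theorem series_eq (M : Scheme k) :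
    M.series = flowSeries (1 / 2) * M.centred * flowSeries (1 / 2) := by
  simp only [series, centred, Finset.mul_sum, Finset.sum_mul, mul_smul_comm, smul_mul_assoc,
    stageSeries_eq]

theorem coeff_centred (M : Scheme k) (n : ℕ) :
    coeff n M.centred = ∑ i, M.b i • coeff n (centredStage (M.a₁ i) (M.a₂ i)) := by
  rw [centred, map_sum]
  rfl

theorem avg_eq (M : Scheme k) (c : ErrorCoeffs → ℝ) :
    M.avg c = ∑ i, M.b i * c (stageCoeffs (M.a₁ i) (M.a₂ i)) := by
  simp only [avg, errorCoeffs_eq]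

theorem avg_smul (M : Scheme k) (c : ErrorCoeffs → ℝ) (P : OpAlg) :
    M.avg c • P = ∑ i, M.b i • c (stageCoeffs (M.a₁ i) (M.a₂ i)) • P := by
  rw [avg_eq, Finset.sum_smul]
  exact Finset.sum_congr rfl fun i _ => (smul_smul _ _ _).symm

/-- The error expansion of a linear combination. -/
theorem coeffs_centred (M : Scheme k) :
    coeff 0 M.centred = M.G00 • 1 ∧ coeff 1 M.centred = 0 ∧ coeff 2 M.centred = 0 ∧
    coeff 3 M.centred = M.G31 • E31 ∧
    coeff 4 M.centred = M.G41 • E41 ∧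
    coeff 5 M.centred = M.G51 • E51 + M.G52 • E52 ∧
    coeff 6 M.centred = M.G61 • E61 + M.G62 • E62 + (M.G63t / 2) • (E31 * E31) ∧
    coeff 7 M.centred = M.G71 • E71 + M.G72 • E72 + M.G73 • E73 + M.G74 • E74
      + (M.G75t / 2) • (E31 * E41 + E41 * E31) := by
  have e6 : M.G63t / 2 = M.avg fun w => w.w31 ^ 2 / 2 := by
    simp only [G63t, avg_eq, Finset.sum_div, mul_div_assoc]
  have e7 : M.G75t / 2 = M.avg fun w => w.w31 * w.w41 / 2 := by
    simp only [G75t, avg_eq, Finset.sum_div, mul_div_assoc]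
  have h := fun i => hasExpansion_centredStage (M.a₁ i) (M.a₂ i)
  simp only [HasExpansion] at h
  refine ⟨?_, ?_, ?_, ?_, ?_, ?_, ?_, ?_⟩ <;>
  · rw [coeff_centred]
    simp only [h, e6, e7, G00, G31, G41, G51, G52, G61, G62, G71, G72, G73, G74, avg_smul,
      smul_add, smul_zero, Finset.sum_add_distrib, Finset.sum_smul, Finset.sum_const_zero]

theorem relation (M : Scheme k) (hb : ∑ i, M.b i = 1) :
    35 / 4 * M.G31 - 63 / 2 * M.G51 + 35 * M.G63t + 36 * M.G71 - 420 * M.G72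
      + 10080 * M.G73 - 420 * M.G74 = 1 := by
  simp only [G31, G51, G63t, G71, G72, G73, G74, avg_eq, Finset.mul_sum]
  simp only [← Finset.sum_add_distrib, ← Finset.sum_sub_distrib]
  rw [← hb]
  refine Finset.sum_congr rfl fun i _ => ?_
  linear_combination M.b i * stageCoeffs_relation (M.a₁ i) (M.a₂ i)

theorem not_hasFormalOrder_seven (M : Scheme k) : ¬ M.HasFormalOrder 7 := by
  intro hM
  have hc : EqUpTo 7 M.centred 1 := by
    have h1 := flowSeries_mul_neg (1 / 2)
    have h2 := flowSeries_neg_mul (1 / 2)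
    have hs : EqUpTo 7 (flowSeries (-(1 / 2)) * M.series * flowSeries (-(1 / 2)))
        (flowSeries (-(1 / 2)) * flowSeries 1 * flowSeries (-(1 / 2))) :=
      ((EqUpTo.refl _ _).mul hM).mul (EqUpTo.refl _ _)
    have e1 : flowSeries (-(1 / 2)) * M.series * flowSeries (-(1 / 2)) = M.centred := by
      rw [series_eq]
      simp only [mul_assoc, h1, mul_one]
      rw [← mul_assoc, h2, one_mul]
    have e2 : flowSeries (-(1 / 2)) * flowSeries 1 * flowSeries (-(1 / 2)) = 1 := by
      rw [flowSeries_mul, flowSeries_mul, ← flowSeries_zero]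
      norm_num
    rwa [e1, e2] at hs
  obtain ⟨c0, -, -, c3, c4, c5, c6, c7⟩ := M.coeffs_centred
  rw [hc _ (by norm_num), coeff_one] at c0 c3 c5 c6 c7
  rw [if_pos rfl] at c0
  rw [if_neg (by norm_num)] at c3 c5 c6 c7
  have g00 : ∑ i, M.b i = 1 := by
    have := congrArg (wordCoeff []) c0
    rw [map_smul, show (1 : OpAlg) = word [] from rfl, wordCoeff_word, if_pos rfl, smul_eq_mul,
      mul_one] at this
    exact this.symm
  have g3 := eq_zero_of_smul_E31 c3.symm
  have g5 := eq_zero_of_degree_five c5.symm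
  have g6 := eq_zero_of_degree_six c6.symm
  have g7 := eq_zero_of_degree_seven c7.symm
  have := M.relation g00
  rw [g3, g5.1, g7.1, g7.2.1, g7.2.2.1, g7.2.2.2.1] at this
  linarith [g6.2.2]

/-- If the order conditions hold but for that of `E73`, the series is that of the flow up to a
multiple of `E73`. -/
theorem series_eqUpTo (M : Scheme k) (h6 : M.OrderSixConditions)
    (h7 : M.OrderSevenTermsVanishExceptG73) :
    EqUpTo 7 M.series (flowSeries (1 / 2) * (1 + monomial 7 (M.G73 • E73)) *
      flowSeries (1 / 2)) := by
  rw [series_eq]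
  refine ((EqUpTo.refl _ _).mul ?_).mul (EqUpTo.refl _ _)
  obtain ⟨g00, g31, g41, g51, g52, g61, g62, g63⟩ := h6
  obtain ⟨g71, g72, g74, g75⟩ := h7
  obtain ⟨c0, c1, c2, c3, c4, c5, c6, c7⟩ := M.coeffs_centred
  rw [g00] at c0
  rw [g31] at c3
  rw [g41] at c4
  rw [g51, g52] at c5
  rw [g61, g62, g63] at c6
  rw [g71, g72, g74, g75] at c7
  intro n hn
  interval_cases n
  · rw [c0, one_smul, map_add, coeff_monomial, if_neg (by norm_num), add_zero, coeff_zero_one]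
  · rw [c1]; simp [coeff_monomial, coeff_one]
  · rw [c2]; simp [coeff_monomial, coeff_one]
  · rw [c3]; simp [coeff_monomial, coeff_one]
  · rw [c4]; simp [coeff_monomial, coeff_one]
  · rw [c5]; simp [coeff_monomial, coeff_one]
  · rw [c6]; simp [coeff_monomial, coeff_one]
  · rw [c7]; simp [coeff_one]

theorem G73_eq (M : Scheme k) (h6 : M.OrderSixConditions)
    (h7 : M.OrderSevenTermsVanishExceptG73) : M.G73 = 1 / 10080 := by
  have := M.relation h6.1
  obtain ⟨g00, g31, g41, g51, g52, g61, g62, g63⟩ := h6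
  obtain ⟨g71, g72, g74, g75⟩ := h7
  rw [g31, g51, g63, g71, g72, g74] at this
  linarith

end Scheme

end GenExtrap

namespace GenExtrap

/-! ### A differential equation on which every linear combination fails -/

/-- The chain `x₀' = 0`, `x_{i+1}' = x_i`. -/
noncomputable def chainField (x : EuclideanSpace ℝ (Fin 8)) : EuclideanSpace ℝ (Fin 8) :=
  !₂[0, x 0, x 1, x 2, x 3, x 4, x 5, x 6]

/-- The flow of the chain. -/
noncomputable def chainFlow (h : ℝ) (x : EuclideanSpace ℝ (Fin 8)) : EuclideanSpace ℝ (Fin 8) :=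
  !₂[x 0,
    x 1 + h * x 0,
    x 2 + h * x 1 + h ^ 2 / 2 * x 0,
    x 3 + h * x 2 + h ^ 2 / 2 * x 1 + h ^ 3 / 6 * x 0,
    x 4 + h * x 3 + h ^ 2 / 2 * x 2 + h ^ 3 / 6 * x 1 + h ^ 4 / 24 * x 0,
    x 5 + h * x 4 + h ^ 2 / 2 * x 3 + h ^ 3 / 6 * x 2 + h ^ 4 / 24 * x 1 + h ^ 5 / 120 * x 0,
    x 6 + h * x 5 + h ^ 2 / 2 * x 4 + h ^ 3 / 6 * x 3 + h ^ 4 / 24 * x 2 + h ^ 5 / 120 * x 1 +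
      h ^ 6 / 720 * x 0,
    x 7 + h * x 6 + h ^ 2 / 2 * x 5 + h ^ 3 / 6 * x 4 + h ^ 4 / 24 * x 3 + h ^ 5 / 120 * x 2 +
      h ^ 6 / 720 * x 1 + h ^ 7 / 5040 * x 0]

/-- Strang splitting of the chain into the links `x₁ → x₂`, `x₃ → x₄`, `x₅ → x₆` (two half steps)
and `x₀ → x₁`, `x₂ → x₃`, `x₄ → x₅`, `x₆ → x₇` (a full step in between). -/
noncomputable def chainStep (h : ℝ) (x : EuclideanSpace ℝ (Fin 8)) : EuclideanSpace ℝ (Fin 8) :=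
  !₂[x 0,
    x 1 + h * x 0,
    x 2 + h * x 1 + h ^ 2 / 2 * x 0,
    x 3 + h * x 2 + h ^ 2 / 2 * x 1,
    x 4 + h * x 3 + h ^ 2 / 2 * x 2 + h ^ 3 / 4 * x 1,
    x 5 + h * x 4 + h ^ 2 / 2 * x 3,
    x 6 + h * x 5 + h ^ 2 / 2 * x 4 + h ^ 3 / 4 * x 3,
    x 7 + h * x 6 + h ^ 2 / 2 * x 5]

theorem contDiff_chainField : ContDiff ℝ ∞ chainField := by
  rw [contDiff_euclidean]
  intro i
  fin_cases i <;> simp [chainField] <;> fun_prop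

theorem contDiff_chainStep :
    ContDiff ℝ ∞ fun p : ℝ × EuclideanSpace ℝ (Fin 8) => chainStep p.1 p.2 := by
  rw [contDiff_euclidean]
  intro i
  fin_cases i <;> simp [chainStep] <;> fun_prop

theorem chainStep_symm (h : ℝ) (x : EuclideanSpace ℝ (Fin 8)) :
    chainStep (-h) (chainStep h x) = x := by
  ext i
  fin_cases i <;> simp [chainStep] <;> ring

theorem hasDerivAt_of_coordinates {d : ℕ} {f : ℝ → EuclideanSpace ℝ (Fin d)}
    {f' : EuclideanSpace ℝ (Fin d)} {t : ℝ} (h : ∀ i, HasDerivAt (fun s => f s i) (f' i) t) :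
    HasDerivAt f f' t := by
  exact (PiLp.continuousLinearEquiv 2 ℝ (fun _ : Fin d => ℝ)).symm.hasFDerivAt.comp_hasDerivAt t
    (hasDerivAt_pi.2 h)

theorem hasDerivAt_taylor_seven (a₀ a₁ a₂ a₃ a₄ a₅ a₆ a₇ t : ℝ) :
    HasDerivAt (fun s : ℝ => a₀ + s * a₁ + s ^ 2 / 2 * a₂ + s ^ 3 / 6 * a₃ + s ^ 4 / 24 * a₄
        + s ^ 5 / 120 * a₅ + s ^ 6 / 720 * a₆ + s ^ 7 / 5040 * a₇)
      (a₁ + t * a₂ + t ^ 2 / 2 * a₃ + t ^ 3 / 6 * a₄ + t ^ 4 / 24 * a₅ + t ^ 5 / 120 * a₆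
        + t ^ 6 / 720 * a₇) t := by
  have hp : ∀ (n : ℕ) (c a : ℝ),
      HasDerivAt (fun s : ℝ => s ^ n / c * a) (n * t ^ (n - 1) / c * a) t :=
    fun n c a => ((hasDerivAt_pow n t).div_const c).mul_const a
  have h := (((((((hasDerivAt_const t a₀).add ((hasDerivAt_id t).mul_const a₁)).add
    (hp 2 2 a₂)).add (hp 3 6 a₃)).add (hp 4 24 a₄)).add (hp 5 120 a₅)).add (hp 6 720 a₆)).add
    (hp 7 5040 a₇)
  refine h.congr_deriv ?_
  push_cast
  ring

theorem hasDerivAt_chainFlow (x : EuclideanSpace ℝ (Fin 8)) (t : ℝ) :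
    HasDerivAt (fun s => chainFlow s x) (chainField (chainFlow t x)) t := by
  refine hasDerivAt_of_coordinates fun i => ?_
  fin_cases i
  · simpa [chainFlow, chainField] using hasDerivAt_taylor_seven (x 0) 0 0 0 0 0 0 0 t
  · simpa [chainFlow, chainField] using hasDerivAt_taylor_seven (x 1) (x 0) 0 0 0 0 0 0 t
  · simpa [chainFlow, chainField] using hasDerivAt_taylor_seven (x 2) (x 1) (x 0) 0 0 0 0 0 t
  · simpa [chainFlow, chainField] using
      hasDerivAt_taylor_seven (x 3) (x 2) (x 1) (x 0) 0 0 0 0 t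
  · simpa [chainFlow, chainField] using
      hasDerivAt_taylor_seven (x 4) (x 3) (x 2) (x 1) (x 0) 0 0 0 t
  · simpa [chainFlow, chainField] using
      hasDerivAt_taylor_seven (x 5) (x 4) (x 3) (x 2) (x 1) (x 0) 0 0 t
  · simpa [chainFlow, chainField] using
      hasDerivAt_taylor_seven (x 6) (x 5) (x 4) (x 3) (x 2) (x 1) (x 0) 0 t
  · simpa [chainFlow, chainField] using
      hasDerivAt_taylor_seven (x 7) (x 6) (x 5) (x 4) (x 3) (x 2) (x 1) (x 0) t

theorem chainFlow_zero (x : EuclideanSpace ℝ (Fin 8)) : chainFlow 0 x = x := by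
  ext i
  fin_cases i <;> simp [chainFlow]

theorem lipschitzWith_chainField : LipschitzWith 1 chainField := by
  refine LipschitzWith.of_dist_le_mul fun x y => ?_
  rw [NNReal.coe_one, one_mul, EuclideanSpace.dist_eq, EuclideanSpace.dist_eq]
  refine Real.sqrt_le_sqrt ?_
  simp [Fin.sum_univ_eight, chainField]

theorem eventuallyEq_chainFlow {x : ℝ → EuclideanSpace ℝ (Fin 8)}
    (hx : IsLocalSolution chainField x) : x =ᶠ[𝓝 0] fun t => chainFlow t (x 0) := by
  refine ODE_solution_unique_of_eventually (v := fun _ => chainField) (s := fun _ => Set.univ)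
    (K := 1) (Filter.Eventually.of_forall fun _ => lipschitzWith_chainField.lipschitzOnWith)
    (hx.mono fun t ht => ⟨ht, Set.mem_univ _⟩)
    (Filter.Eventually.of_forall fun t => ⟨hasDerivAt_chainFlow _ t, Set.mem_univ _⟩)
    (chainFlow_zero _).symm

/-- The defect of `chainStep`, divided by `h ^ 3`. -/
noncomputable def chainDefect (h : ℝ) (x : EuclideanSpace ℝ (Fin 8)) : EuclideanSpace ℝ (Fin 8) :=
  !₂[0,
    0,
    0,
    -1/6 * x 0,
    1/12 * x 1 - 1/24 * h * x 0,
    -1/6 * x 2 - 1/24 * h * x 1 - 1/120 * h ^ 2 * x 0,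
    1/12 * x 3 - 1/24 * h * x 2 - 1/120 * h ^ 2 * x 1 - 1/720 * h ^ 3 * x 0,
    -1/6 * x 4 - 1/24 * h * x 3 - 1/120 * h ^ 2 * x 2 - 1/720 * h ^ 3 * x 1 - 1/5040 * h ^ 4 * x 0]

theorem chainStep_sub_chainFlow (h : ℝ) (x : EuclideanSpace ℝ (Fin 8)) :
    chainStep h x - chainFlow h x = h ^ 3 • chainDefect h x := by
  ext i
  fin_cases i <;> simp [chainStep, chainFlow, chainDefect] <;> ring

theorem isBasicScheme_chainStep : IsBasicScheme chainField chainStep where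
  smooth := contDiff_chainStep
  symm := chainStep_symm
  order_two := by
    intro x hx
    have hc : Continuous fun h => chainDefect h (x 0) := by
      refine (PiLp.continuous_toLp 2 _).comp (continuous_pi fun i => ?_)
      fin_cases i <;> simp <;> fun_prop
    have h1 : (fun h => chainDefect h (x 0)) =O[𝓝 0] fun _ => (1 : ℝ) :=
      hc.continuousAt.isBigO_one ℝ
    have h2 := (Asymptotics.isBigO_refl (fun h : ℝ => h ^ 3) (𝓝 0)).smul h1
    refine h2.congr' ?_ (by simp)
    filter_upwards [eventuallyEq_chainFlow hx] with h hh
    rw [hh, chainStep_sub_chainFlow]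

/-- Three steps of the splitting do not reach `x₇` from `x₀`, which takes four full steps. -/
theorem chainStep_chainStep_chainStep_apply_seven (h₁ h₂ h₃ : ℝ) :
    chainStep h₁ (chainStep h₂ (chainStep h₃ !₂[1, 0, 0, 0, 0, 0, 0, 0])) 7 = 0 := by
  simp [chainStep]

/-- Applied to the chain, the seventh coordinate of a step from `(1, 0, …, 0)` is zero, whereas that
of the flow is `h ^ 7 / 7!`. -/
theorem Scheme.not_hasOrder_seven {k : ℕ} (M : Scheme k) : ¬ M.HasOrder 7 := by
  intro hM
  set e : EuclideanSpace ℝ (Fin 8) := !₂[1, 0, 0, 0, 0, 0, 0, 0] with he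
  have h1 := hM 8 chainField chainStep contDiff_chainField isBasicScheme_chainStep
    (fun t => chainFlow t e) (Filter.Eventually.of_forall fun t => hasDerivAt_chainFlow e t)
  simp only [chainFlow_zero] at h1
  have h2 : (fun h : ℝ => h ^ 7) =O[𝓝 0] fun h : ℝ => h ^ 8 := by
    refine (Asymptotics.IsBigO.of_bound 5040 (Filter.Eventually.of_forall fun h => ?_)).trans h1
    have h3 : (M.step chainStep h e - chainFlow h e) 7 = -(h ^ 7 / 5040) := by
      have h4 : M.step chainStep h e 7 = 0 := by
        simp [Scheme.step, he, chainStep_chainStep_chainStep_apply_seven]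
      rw [PiLp.sub_apply, h4]
      simp [chainFlow, he]
    have h5 := PiLp.norm_apply_le (M.step chainStep h e - chainFlow h e) 7
    rw [h3, norm_neg, norm_div, Real.norm_of_nonneg (by norm_num : (0 : ℝ) ≤ 5040)] at h5
    linarith
  -- `h ^ 7 = O(h ^ 8)` is absurd
  have h3 : (fun h : ℝ => h ^ 7) =o[𝓝 0] fun h : ℝ => h ^ 7 :=
    h2.trans_isLittleO (Asymptotics.isLittleO_pow_pow (by norm_num))
  have h4 := h3.def (by norm_num : (0 : ℝ) < 1 / 2)
  obtain ⟨ε, hε, hb⟩ := Metric.eventually_nhds_iff.1 h4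
  have h6 := hb (y := ε / 2) (by rw [Real.dist_eq, sub_zero, abs_of_pos (by positivity)]; linarith)
  have h7 : 0 < ‖(ε / 2) ^ 7‖ := norm_pos_iff.2 (by positivity)
  linarith

end GenExtrap

namespace GenExtrap

/-! ### Polynomial expressions and their enclosures -/

/-- Polynomial expressions in two variables. -/
inductive PolyExpr
  | const (q : ℚ)
  | varX
  | varY
  | add (e f : PolyExpr)
  | mul (e f : PolyExpr)

namespace PolyExpr

/-- The value of an expression at a point. -/
noncomputable def eval (x y : ℝ) : PolyExpr → ℝ
  | const q => q
  | varX => x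
  | varY => y
  | add e f => eval x y e + eval x y f
  | mul e f => eval x y e * eval x y f

/-- Powers of an expression. -/
def pow (e : PolyExpr) : ℕ → PolyExpr
  | 0 => const 1
  | 1 => e
  | n + 2 => mul (pow e (n + 1)) e

/-- The formal derivative in a direction in which the variables have the derivatives `p` and `q`. -/
def diff (p q : ℚ) : PolyExpr → PolyExpr
  | const _ => const 0
  | varX => const p
  | varY => const q
  | add e f => add (diff p q e) (diff p q f)
  | mul e f => add (mul (diff p q e) f) (mul e (diff p q f))

theorem eval_pow (x y : ℝ) (e : PolyExpr) (n : ℕ) : eval x y (pow e n) = eval x y e ^ n := by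
  induction n using Nat.strong_induction_on with
  | _ n ih =>
    match n with
    | 0 => simp [pow, eval]
    | 1 => simp [pow]
    | n + 2 => rw [pow, eval, ih (n + 1) (by omega), pow_succ _ (n + 1)]

theorem hasDerivAt_eval {x y : ℝ → ℝ} {x' y' t : ℝ} (hx : HasDerivAt x x' t)
    (hy : HasDerivAt y y' t) (e : PolyExpr) :
    HasDerivAt (fun s => eval (x s) (y s) e)
      (eval (x t) (y t) (diff 1 0 e) * x' + eval (x t) (y t) (diff 0 1 e) * y') t := by
  induction e with
  | const q => simpa [eval, diff] using hasDerivAt_const t (q : ℝ)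
  | varX => simpa [eval, diff] using hx
  | varY => simpa [eval, diff] using hy
  | add e f he hf =>
    refine (he.add hf).congr_deriv ?_
    simp only [eval, diff]
    ring
  | mul e f he hf =>
    refine (he.mul hf).congr_deriv ?_
    simp only [eval, diff]
    ring

/-- The real number `v` lies in the interval with centre `B.1` and radius `B.2`. -/
def Encloses (B : ℚ × ℚ) (v : ℝ) : Prop := |v - B.1| ≤ B.2

/-- Sum of intervals. -/
def addBall (A B : ℚ × ℚ) : ℚ × ℚ := (A.1 + B.1, A.2 + B.2)

/-- Product of intervals. -/
def mulBall (A B : ℚ × ℚ) : ℚ × ℚ := (A.1 * B.1, |A.1| * B.2 + A.2 * |B.1| + A.2 * B.2)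

theorem Encloses.add {A B : ℚ × ℚ} {v w : ℝ} (hA : Encloses A v) (hB : Encloses B w) :
    Encloses (addBall A B) (v + w) := by
  simp only [Encloses, addBall, Rat.cast_add] at *
  calc |v + w - (A.1 + B.1)| = |(v - A.1) + (w - B.1)| := by ring_nf
    _ ≤ |v - A.1| + |w - B.1| := abs_add_le _ _
    _ ≤ _ := add_le_add hA hB

theorem Encloses.mul {A B : ℚ × ℚ} {v w : ℝ} (hA : Encloses A v) (hB : Encloses B w) :
    Encloses (mulBall A B) (v * w) := by
  simp only [Encloses, mulBall, Rat.cast_add, Rat.cast_mul, Rat.cast_abs] at *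
  calc |v * w - A.1 * B.1| = |A.1 * (w - B.1) + (v - A.1) * B.1 + (v - A.1) * (w - B.1)| := by
        ring_nf
    _ ≤ |A.1 * (w - B.1)| + |(v - A.1) * B.1| + |(v - A.1) * (w - B.1)| := abs_add_three _ _ _
    _ = |(A.1 : ℝ)| * |w - B.1| + |v - A.1| * |(B.1 : ℝ)| + |v - A.1| * |w - B.1| := by
        rw [abs_mul, abs_mul, abs_mul]
    _ ≤ _ := by
        have := (abs_nonneg _).trans hA
        gcongr

/-- Interval evaluation. -/
def ball (X Y : ℚ × ℚ) : PolyExpr → ℚ × ℚ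
  | const q => (q, 0)
  | varX => X
  | varY => Y
  | add e f => addBall (ball X Y e) (ball X Y f)
  | mul e f => mulBall (ball X Y e) (ball X Y f)

theorem encloses_ball {X Y : ℚ × ℚ} {x y : ℝ} (hx : Encloses X x) (hy : Encloses Y y)
    (e : PolyExpr) : Encloses (ball X Y e) (eval x y e) := by
  induction e with
  | const q => simp [Encloses, ball, eval]
  | varX => exact hx
  | varY => exact hy
  | add e f he hf => exact he.add hf
  | mul e f he hf => exact he.mul hf

end PolyExpr

/-! ### A quantitative inverse function theorem -/

/-- A Newton-Kantorovich criterion. The matrix `J` approximates the derivative of `F` on a box, and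
the matrix `A` approximates the inverse of `J`. -/
theorem exists_zero_of_approximate_inverse {ι κ : Type*} [Fintype ι] [Fintype κ] [DecidableEq ι]
    [DecidableEq κ] (F : (ι → ℝ) → κ → ℝ) (DF : (ι → ℝ) → κ → ι → ℝ) (X₀ : ι → ℝ)
    (A : ι → κ → ℝ) (J : κ → ι → ℝ) (ε η : ℝ) (hε : 0 ≤ ε)
    (hF : ∀ (X V : ι → ℝ) (t : ℝ) (m : κ),
      HasDerivAt (fun s : ℝ => F (X + s • V) m) (∑ j, DF (X + t • V) m j * V j) t)
    (hDF : ∀ X : ι → ℝ, (∀ i, |X i - X₀ i| ≤ ε) → ∀ m j, |DF X m j - J m j| ≤ η)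
    (hAJ : ∀ i, ∑ j, (|∑ m, A i m * J m j - if i = j then 1 else 0| + η * ∑ m, |A i m|) ≤ 1 / 2)
    (hJA : ∀ m, ∑ n, |∑ i, J m i * A i n - if m = n then 1 else 0| ≤ 1 / 2)
    (hX₀ : ∀ i, |∑ m, A i m * F X₀ m| ≤ ε / 2) :
    ∃ X, ∀ m, F X m = 0 := by
  set G : (ι → ℝ) → ι → ℝ := fun X i => ∑ m, A i m * F X m with hG
  have hball : ∀ X, X ∈ Metric.closedBall X₀ ε ↔ ∀ i, |X i - X₀ i| ≤ ε := fun X => by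
    rw [mem_closedBall_iff_norm, pi_norm_le_iff_of_nonneg hε]
    rfl
  -- on the box, the derivative of `G` differs from the identity by at most `1 / 2`
  have happrox : ApproximatesLinearOn G (ContinuousLinearMap.id ℝ (ι → ℝ))
      (Metric.closedBall X₀ ε) (1 / 2) := by
    intro X hX Y hY
    rw [pi_norm_le_iff_of_nonneg (by positivity)]
    intro i
    have hd : ∀ t : ℝ, HasDerivAt (fun s : ℝ => G (Y + s • (X - Y)) i - s * (X - Y) i)
        (∑ m, A i m * ∑ j, DF (Y + t • (X - Y)) m j * (X - Y) j - (X - Y) i) t := by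
      intro t
      have h1 := HasDerivAt.fun_sum (u := Finset.univ) fun m _ =>
        (hF Y (X - Y) t m).const_mul (A i m)
      exact (h1.sub ((hasDerivAt_id t).mul_const ((X - Y) i))).congr_deriv (by simp)
    obtain ⟨t, ht, hslope⟩ := exists_hasDerivAt_eq_slope _ _ zero_lt_one
      (fun t _ => (hd t).continuousAt.continuousWithinAt) (fun t _ => hd t)
    have hZ : Y + t • (X - Y) ∈ Metric.closedBall X₀ ε :=
      (convex_closedBall X₀ ε).add_smul_sub_mem hY hX ⟨ht.1.le, ht.2.le⟩
    set Z := Y + t • (X - Y) with hZdef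
    have hval : (G X - G Y - ContinuousLinearMap.id ℝ (ι → ℝ) (X - Y)) i =
        ∑ j, (∑ m, A i m * DF Z m j - if i = j then 1 else 0) * (X - Y) j := by
      have e1 : ∑ j, (∑ m, A i m * DF Z m j - if i = j then 1 else 0) * (X - Y) j =
          ∑ m, A i m * ∑ j, DF Z m j * (X - Y) j - (X - Y) i := by
        simp only [sub_mul, Finset.sum_sub_distrib, ite_mul, one_mul, zero_mul,
          Finset.sum_ite_eq, Finset.mem_univ, if_true, Finset.sum_mul, Finset.mul_sum]
        rw [Finset.sum_comm]
        simp only [mul_assoc]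
      rw [e1, hslope]
      simp
      ring
    rw [hval, Real.norm_eq_abs]
    calc |∑ j, (∑ m, A i m * DF Z m j - if i = j then 1 else 0) * (X - Y) j|
        ≤ ∑ j, |(∑ m, A i m * DF Z m j - if i = j then 1 else 0) * (X - Y) j| :=
          Finset.abs_sum_le_sum_abs _ _
      _ ≤ ∑ j, (|∑ m, A i m * J m j - if i = j then 1 else 0| + η * ∑ m, |A i m|) * ‖X - Y‖ := by
          refine Finset.sum_le_sum fun j _ => ?_
          have e2 : ∑ m, A i m * DF Z m j - (if i = j then 1 else 0) =
              (∑ m, A i m * J m j - if i = j then 1 else 0)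
                + ∑ m, A i m * (DF Z m j - J m j) := by
            simp only [mul_sub, Finset.sum_sub_distrib]
            ring
          have e3 : |∑ m, A i m * DF Z m j - if i = j then 1 else 0| ≤
              |∑ m, A i m * J m j - if i = j then 1 else 0| + η * ∑ m, |A i m| := by
            rw [e2]
            refine (abs_add_le _ _).trans (add_le_add le_rfl ?_)
            refine (Finset.abs_sum_le_sum_abs _ _).trans ?_
            rw [Finset.mul_sum]
            refine Finset.sum_le_sum fun m _ => ?_
            rw [abs_mul, mul_comm]
            exact mul_le_mul_of_nonneg_right (hDF Z ((hball Z).1 hZ) m j) (abs_nonneg _)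
          rw [abs_mul]
          exact mul_le_mul e3 (norm_le_pi_norm (X - Y) j) (abs_nonneg _)
            ((abs_nonneg _).trans e3)
      _ = (∑ j, (|∑ m, A i m * J m j - if i = j then 1 else 0| + η * ∑ m, |A i m|)) * ‖X - Y‖ := by
          rw [Finset.sum_mul]
      _ ≤ ((1 / 2 : NNReal) : ℝ) * ‖X - Y‖ := by
          refine mul_le_mul_of_nonneg_right ((hAJ i).trans ?_) (norm_nonneg _)
          norm_num
  let inv : (ContinuousLinearMap.id ℝ (ι → ℝ)).NonlinearRightInverse :=
    { toFun := id
      nnnorm := 1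
      bound' := fun y => by simp
      right_inv' := fun y => rfl }
  have hsurj := happrox.surjOn_closedBall_of_nonlinearRightInverse inv hε le_rfl
  have h0 : (0 : ι → ℝ) ∈ Metric.closedBall (G X₀)
      ((((inv.nnnorm : ℝ))⁻¹ - ((1 / 2 : NNReal) : ℝ)) * ε) := by
    have e : (((inv.nnnorm : ℝ))⁻¹ - ((1 / 2 : NNReal) : ℝ)) * ε = ε / 2 := by
      simp [inv]
      ring
    rw [e, mem_closedBall_iff_norm, zero_sub, norm_neg, pi_norm_le_iff_of_nonneg (by linarith)]
    exact hX₀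
  obtain ⟨X, -, hX⟩ := hsurj h0
  refine ⟨X, fun m => ?_⟩
  -- `A` is injective, as `J * A` is close to the identity
  have hn : ‖F X‖ ≤ 1 / 2 * ‖F X‖ := by
    rw [pi_norm_le_iff_of_nonneg (by positivity)]
    intro m
    have e3 : ∑ n, (∑ i, J m i * A i n - if m = n then 1 else 0) * F X n = - F X m := by
      have : ∑ n, (∑ i, J m i * A i n) * F X n = ∑ i, J m i * G X i := by
        simp only [hG, Finset.sum_mul, Finset.mul_sum]
        rw [Finset.sum_comm]
        simp only [mul_assoc]
      simp only [sub_mul, Finset.sum_sub_distrib, this, hX]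
      simp
    rw [← norm_neg, ← e3, Real.norm_eq_abs]
    calc |∑ n, (∑ i, J m i * A i n - if m = n then 1 else 0) * F X n|
        ≤ ∑ n, |(∑ i, J m i * A i n - if m = n then 1 else 0) * F X n| :=
          Finset.abs_sum_le_sum_abs _ _
      _ ≤ ∑ n, |∑ i, J m i * A i n - if m = n then 1 else 0| * ‖F X‖ := by
          refine Finset.sum_le_sum fun n _ => ?_
          rw [abs_mul]
          exact mul_le_mul_of_nonneg_left (norm_le_pi_norm (F X) n) (abs_nonneg _)
      _ ≤ 1 / 2 * ‖F X‖ := by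
          rw [← Finset.sum_mul]
          exact mul_le_mul_of_nonneg_right (hJA m) (norm_nonneg _)
  have : ‖F X‖ = 0 := le_antisymm (by linarith) (norm_nonneg _)
  rw [norm_eq_zero.1 this]
  rfl

end GenExtrap

namespace GenExtrap

open PolyExpr

/-! ### The order conditions as polynomial equations -/

namespace PolyExpr

instance : Add PolyExpr := ⟨add⟩
instance : Mul PolyExpr := ⟨mul⟩

theorem eval_const (x y : ℝ) (q : ℚ) : eval x y (const q) = q := rfl
theorem eval_varX (x y : ℝ) : eval x y varX = x := rfl
theorem eval_varY (x y : ℝ) : eval x y varY = y := rfl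
theorem eval_add (x y : ℝ) (e f : PolyExpr) : eval x y (e + f) = eval x y e + eval x y f := rfl
theorem eval_mul (x y : ℝ) (e f : PolyExpr) : eval x y (e * f) = eval x y e * eval x y f := rfl

/-- The step `1 - x - y` of the first factor of the series of a composition. -/
def firstStep : PolyExpr := const 1 + const (-1) * (varX + varY)

/-- The shift of the first factor. -/
def firstShift : PolyExpr := const (-1 / 2) * (varX + varY)

/-- The shift of the second factor, the step of which is `y`. -/
def secondShift : PolyExpr := const (1 / 2) + const (-1) * varX + const (-1 / 2) * varY

/-- The shift of the third factor, the step of which is `x`. -/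
def thirdShift : PolyExpr := const (1 / 2) + const (-1 / 2) * varX

/-- The sum over the three factors of an expression in the step and the shift. -/
def stageSum (g : PolyExpr → PolyExpr → PolyExpr) : PolyExpr :=
  g firstStep firstShift + g varY secondShift + g varX thirdShift

/-- The coefficient of `E31` of one factor. -/
def cube (c _s : PolyExpr) : PolyExpr := pow c 3

/-- The coefficient of `E41` of one factor. -/
def cubeShift (c s : PolyExpr) : PolyExpr := pow c 3 * s

/-- The functions of `(a₁, a₂)` the averages of which are prescribed by the order conditions:
the constant `1` and the error coefficients but for `w73`, with `w31 ^ 2` and `w31 * w41`. -/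
def condition : Fin 12 → PolyExpr := ![
  const 1,
  stageSum cube,
  stageSum cubeShift,
  stageSum fun c _ => pow c 5,
  stageSum fun c s => const (1 / 24) * pow c 5 + const (1 / 2) * (pow c 3 * pow s 2),
  stageSum fun c s => pow c 5 * s,
  stageSum fun c s => const (1 / 24) * (pow c 5 * s) + const (1 / 6) * (pow c 3 * pow s 3),
  pow (stageSum cube) 2,
  stageSum fun c _ => pow c 7,
  stageSum fun c s => const (1 / 24) * pow c 7 + const (1 / 2) * (pow c 5 * pow s 2),
  (stageSum fun c _ => const (1 / 12) * pow c 7) + const (1 / 2) *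
    (cube firstStep firstShift * cubeShift varY secondShift
      + const (-1) * (cube varY secondShift * cubeShift firstStep firstShift)
      + (cube firstStep firstShift + cube varY secondShift) * cubeShift varX thirdShift
      + const (-1) * (cube varX thirdShift *
        (cubeShift firstStep firstShift + cubeShift varY secondShift))),
  stageSum cube * stageSum cubeShift]

end PolyExpr

/-- The functions of the error coefficients which correspond to `PolyExpr.condition`. -/
noncomputable def conditionCoeff : Fin 12 → ErrorCoeffs → ℝ := ![
  fun _ => 1, fun w => w.w31, fun w => w.w41, fun w => w.w51, fun w => w.w52, fun w => w.w61,
  fun w => w.w62, fun w => w.w31 ^ 2, fun w => w.w71, fun w => w.w72, fun w => w.w74,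
  fun w => w.w31 * w.w41]

theorem eval_condition (a₁ a₂ : ℝ) (m : Fin 12) :
    eval a₁ a₂ (condition m) = conditionCoeff m (stageCoeffs a₁ a₂) := by
  fin_cases m <;>
  · simp [condition, conditionCoeff, stageSum, cube, cubeShift, firstStep, firstShift, secondShift,
      thirdShift, eval_const, eval_varX, eval_varY, eval_add, eval_mul, eval_pow, stageCoeffs,
      ErrorCoeffs.comp, stepCoeffs]
    try ring

/-- The residuals of the order conditions, for the weights `X (i, 0)` and the parameters
`X (i, 1)`, `X (i, 2)`. -/
noncomputable def residual (X : Fin 4 × Fin 3 → ℝ) (m : Fin 12) : ℝ :=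
  ∑ i, X (i, 0) * eval (X (i, 1)) (X (i, 2)) (condition m) - if m = 0 then 1 else 0

/-- The partial derivatives of the residuals. -/
noncomputable def residualDeriv (X : Fin 4 × Fin 3 → ℝ) (m : Fin 12) (j : Fin 4 × Fin 3) : ℝ :=
  ![eval (X (j.1, 1)) (X (j.1, 2)) (condition m),
    X (j.1, 0) * eval (X (j.1, 1)) (X (j.1, 2)) (diff 1 0 (condition m)),
    X (j.1, 0) * eval (X (j.1, 1)) (X (j.1, 2)) (diff 0 1 (condition m))] j.2

theorem hasDerivAt_residual (X V : Fin 4 × Fin 3 → ℝ) (t : ℝ) (m : Fin 12) :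
    HasDerivAt (fun s : ℝ => residual (X + s • V) m)
      (∑ j, residualDeriv (X + t • V) m j * V j) t := by
  have hl : ∀ j, HasDerivAt (fun s : ℝ => (X + s • V) j) (V j) t := fun j => by
    simpa using ((hasDerivAt_id t).mul_const (V j)).const_add (X j)
  have h := (HasDerivAt.fun_sum (u := Finset.univ) fun (i : Fin 4) _ =>
    (hl (i, 0)).mul (hasDerivAt_eval (hl (i, 1)) (hl (i, 2)) (condition m))).sub_const
      (if m = 0 then (1 : ℝ) else 0)
  refine h.congr_deriv ?_
  rw [Fintype.sum_prod_type]
  refine Finset.sum_congr rfl fun i _ => ?_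
  rw [Fin.sum_univ_three]
  simp only [residualDeriv, Matrix.cons_val]
  ring

/-! ### An approximate solution -/

/-- An approximate solution of the order conditions: row `i` holds the weight of the `i`-th
composition and its parameters `a₁` and `a₂`. -/
def approxSolution (j : Fin 4 × Fin 3) : ℚ :=
  (![![1899497515555333, 378504344912201, 267183793196010],
    ![60495578968273, 1004212893917853, -1617959964066816],
    ![-959924530405633, -55770524529953, 515580864788333],
    ![-68564117973, -1967146394863210, 720548099756546]] : Fin 4 → Fin 3 → ℚ) j.1 j.2 / 10 ^ 15

/-- The derivative of the residuals at the approximate solution, rounded. -/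
def approxJacobian (m : Fin 12) (j : Fin 4 × Fin 3) : ℚ :=
  (![![1000000, 0, 0, 1000000, 0, 0, 1000000, 0, 0, 1000000, 0, 0],
    ![117779, 101027, -308572, 979693, -289605, 2471, 294510, 831375, 74820, 4100943, 242, 931],
    ![2260, 354671, 165673, -3338, -46941, 756, 4508, 9209, -279867, -3437455, -380, 824],
    ![14714, 45260, -101275, 877641, -1743722, 21505, 82429, 408642, 69536, 27968021, 3600,
      8641],
    ![5551, 2095, -27614, 37745, -55763, 743, 13661, 59752, -6672, -4178929, -615, 594],
    ![595, 93630, 41140, -22863, -321317, 6577, 281, -36935, -155457, -7620197, -1207, 7217],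
    ![47, 7305, 3523, -694, -9750, 204, 293, 4368, -6635, -3419487, -596, 280],
    ![13872, 23798, -72687, 959798, -567448, 4841, 86736, 489697, 44071, 16817736, 1987, 7639],
    ![1911, 12793, -21469, 504944, -7044557, 117914, 23107, 166960, 40744, 174967189, 33898,
      61642],
    ![746, 1595, -6963, 21423, -287208, 5217, 3796, 23096, -2424, -13578442, -2788, 5297],
    ![1222, 762, -8190, 61471, -310767, 5230, 7615, 48771, 1917, -18512569, -3954, 2402],
    ![266, 42001, 18815, -3270, -45021, 732, 1328, 6460, -82086, -14096809, -2392, 176]] :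
    Fin 12 → Fin 12 → ℚ) m (finProdFinEquiv j) / 10 ^ 6

/-- The inverse of the derivative of the residuals at the approximate solution, rounded. -/
def approxInverse (j : Fin 4 × Fin 3) (m : Fin 12) : ℚ :=
  (![![18995, -197636, 33216, 6241, 2326911, 701172, 2368712, 74301, -26695, -1561107,
      1114481, -1897853],
    ![0, -18681, -28148, 63710, 345788, 379492, 2722683, -40134, -16121, -653642, 288481,
      -837480],
    ![0, 37172, 85956, -90573, -721805, -614914, -2886870, 54267, 27066, 979128, -463829,
      1123487],
    ![605, -13143, -52556, 27688, 116293, 268039, 1820127, 687, -7918, -501650, 217806,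
      -457198],
    ![0, -5766, -27483, -12429, 127874, 200698, 1086555, 10893, -2346, -407792, 247451,
      -377890],
    ![0, -353293, -1832085, -626096, 7910097, 12711971, 71650501, 461649, -75978, -27242347,
      16799119, -23708145],
    ![-9599, 210746, 18310, -33455, -2442572, -966407, -4148449, -75217, 34597, 2056627,
      -1331905, 2350367],
    ![0, -4228, 79845, -66074, 114016, -312289, -2251644, 43472, 12496, 456380, -113271,
      445525],
    ![0, 94, -22036, 27211, -8010, 105130, 1806377, -19584, -3612, -227063, 68002, -372028],
    ![-1, 33, 1030, -475, -632, -2804, -40390, 229, 17, 6130, -382, 4685],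
    ![0, -125056, -4844995, 2068957, 3363792, 13042375, 190990029, -922080, 37719, -29364661,
      291855, -21856621],
    ![0, 56086, 361998, -111602, -1308714, -1964991, -13365016, 162454, 5459, 7033095,
      -4209831, 3414399]] :
    Fin 12 → Fin 12 → ℚ) (finProdFinEquiv j) m / 10 ^ 4

/-- Enclosure of the residuals, for unknowns enclosed by `B`. -/
def residualBall (B : Fin 4 × Fin 3 → ℚ × ℚ) (m : Fin 12) : ℚ × ℚ :=
  let b (i : Fin 4) := mulBall (B (i, 0)) (ball (B (i, 1)) (B (i, 2)) (condition m))
  addBall (addBall (addBall (addBall (b 0) (b 1)) (b 2)) (b 3)) (if m = 0 then -1 else 0, 0)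

/-- Enclosure of the partial derivatives of the residuals, for unknowns enclosed by `B`. -/
def residualDerivBall (B : Fin 4 × Fin 3 → ℚ × ℚ) (m : Fin 12) (j : Fin 4 × Fin 3) : ℚ × ℚ :=
  ![ball (B (j.1, 1)) (B (j.1, 2)) (condition m),
    mulBall (B (j.1, 0)) (ball (B (j.1, 1)) (B (j.1, 2)) (diff 1 0 (condition m))),
    mulBall (B (j.1, 0)) (ball (B (j.1, 1)) (B (j.1, 2)) (diff 0 1 (condition m)))] j.2

theorem approxInverse_mul_approxJacobian : ∀ i, ∑ j, (|∑ m, approxInverse i m * approxJacobian m j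
    - if i = j then 1 else 0| + 1 / 10 ^ 6 * ∑ m, |approxInverse i m|) ≤ 1 / 2 := by
  decide +kernel

theorem approxJacobian_mul_approxInverse : ∀ m, ∑ n, |∑ i, approxJacobian m i * approxInverse i n
    - if m = n then 1 else 0| ≤ 1 / 2 := by
  decide +kernel

/-- On the box of radius `10 ^ (-12)` about the approximate solution, the derivative stays within
`10 ^ (-6)` of its rounded value. -/
theorem residualDerivBall_approxSolution : ∀ m j,
    |(residualDerivBall (fun i => (approxSolution i, 1 / 10 ^ 12)) m j).1 - approxJacobian m j|
      + (residualDerivBall (fun i => (approxSolution i, 1 / 10 ^ 12)) m j).2 ≤ 1 / 10 ^ 6 := by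
  decide +kernel

/-- A Newton step from the approximate solution moves it by at most half the radius of the box. -/
theorem residualBall_approxSolution : ∀ j,
    |∑ m, approxInverse j m * (residualBall (fun i => (approxSolution i, 0)) m).1|
      + ∑ m, |approxInverse j m| * (residualBall (fun i => (approxSolution i, 0)) m).2
      ≤ 1 / 10 ^ 12 / 2 := by
  decide +kernel

/-! ### Existence of a solution of the order conditions -/

theorem encloses_residual {B : Fin 4 × Fin 3 → ℚ × ℚ} {X : Fin 4 × Fin 3 → ℝ}
    (h : ∀ j, Encloses (B j) (X j)) (m : Fin 12) : Encloses (residualBall B m) (residual X m) := by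
  have hb := fun i => (h (i, 0)).mul (encloses_ball (h (i, 1)) (h (i, 2)) (condition m))
  have ht : Encloses (if m = 0 then -1 else 0, 0) (-(if m = 0 then 1 else 0)) := by
    split_ifs <;> simp [Encloses]
  rw [residual, Fin.sum_univ_four, sub_eq_add_neg]
  exact ((((hb 0).add (hb 1)).add (hb 2)).add (hb 3)).add ht

theorem encloses_residualDeriv {B : Fin 4 × Fin 3 → ℚ × ℚ} {X : Fin 4 × Fin 3 → ℝ}
    (h : ∀ j, Encloses (B j) (X j)) (m : Fin 12) (j : Fin 4 × Fin 3) :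
    Encloses (residualDerivBall B m j) (residualDeriv X m j) := by
  obtain ⟨i, s⟩ := j
  fin_cases s
  · exact encloses_ball (h (i, 1)) (h (i, 2)) _
  · exact (h (i, 0)).mul (encloses_ball (h (i, 1)) (h (i, 2)) _)
  · exact (h (i, 0)).mul (encloses_ball (h (i, 1)) (h (i, 2)) _)

theorem exists_residual_eq_zero : ∃ X, ∀ m, residual X m = 0 := by
  refine exists_zero_of_approximate_inverse residual residualDeriv (fun j => approxSolution j)
    (fun j m => approxInverse j m) (fun m j => approxJacobian m j) (1 / 10 ^ 12) (1 / 10 ^ 6)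
    (by positivity) hasDerivAt_residual ?_ ?_ ?_ ?_
  · intro X hX m j
    have hB : ∀ i, Encloses (approxSolution i, 1 / 10 ^ 12) (X i) := fun i => by
      simpa [Encloses] using hX i
    have h1 := encloses_residualDeriv hB m j
    have h2 : _ ≤ ((1 / 10 ^ 6 : ℚ) : ℝ) := Rat.cast_le.2 (residualDerivBall_approxSolution m j)
    rw [Encloses] at h1
    push_cast at h2
    have h3 := abs_sub_le (residualDeriv X m j)
      (residualDerivBall (fun i => (approxSolution i, 1 / 10 ^ 12)) m j).1 (approxJacobian m j)
    linarith
  · intro i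
    have h : _ ≤ ((1 / 2 : ℚ) : ℝ) := Rat.cast_le.2 (approxInverse_mul_approxJacobian i)
    push_cast [apply_ite (Rat.cast : ℚ → ℝ)] at h
    exact h
  · intro m
    have h : _ ≤ ((1 / 2 : ℚ) : ℝ) := Rat.cast_le.2 (approxJacobian_mul_approxInverse m)
    push_cast [apply_ite (Rat.cast : ℚ → ℝ)] at h
    exact h
  · intro j
    have hB : ∀ i, Encloses (approxSolution i, 0) (approxSolution i : ℝ) := fun i => by
      simp [Encloses]
    have h1 := fun m => encloses_residual hB m
    have h2 : _ ≤ ((1 / 10 ^ 12 / 2 : ℚ) : ℝ) := Rat.cast_le.2 (residualBall_approxSolution j)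
    push_cast at h2
    refine le_trans ?_ h2
    set r := fun m => residualBall (fun i => (approxSolution i, 0)) m with hr
    have e : ∑ m, (approxInverse j m : ℝ) * residual (fun j => (approxSolution j : ℝ)) m =
        ∑ m, (approxInverse j m : ℝ) * (r m).1 + ∑ m, (approxInverse j m : ℝ) *
          (residual (fun j => (approxSolution j : ℝ)) m - (r m).1) := by
      simp only [mul_sub, Finset.sum_sub_distrib]
      ring
    rw [e]
    refine (abs_add_le _ _).trans (add_le_add le_rfl ?_)
    refine (Finset.abs_sum_le_sum_abs _ _).trans (Finset.sum_le_sum fun m _ => ?_)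
    rw [abs_mul]
    exact mul_le_mul_of_nonneg_left (h1 m) (abs_nonneg _)

/-- The twelve conditions on four weights and eight parameters have a real solution. -/
theorem exists_orderConditions : ∃ M : Scheme 4,
    M.OrderSixConditions ∧ M.OrderSevenTermsVanishExceptG73 := by
  obtain ⟨X, hX⟩ := exists_residual_eq_zero
  let M : Scheme 4 := ⟨fun i => X (i, 0), fun i => X (i, 1), fun i => X (i, 2)⟩
  have h : ∀ m, M.avg (conditionCoeff m) = if m = 0 then 1 else 0 := fun m => by
    have := hX m
    rw [residual, sub_eq_zero] at this
    rw [← this, Scheme.avg_eq]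
    simp only [M, eval_condition]
  have h0 : M.G00 = 1 := by
    have := h 0
    simpa [Scheme.avg, conditionCoeff, Scheme.G00] using this
  exact ⟨M, ⟨h0, h 1, h 2, h 3, h 4, h 5, h 6, h 7⟩, h 8, h 9, h 10, h 11⟩

end GenExtrap

theorem mainTheorem3 :
    -- the coefficients `w_{mn}` are well defined
    (∀ a₁ a₂ : ℝ, ∃! w : GenExtrap.ErrorCoeffs, GenExtrap.IsErrorCoeffs a₁ a₂ w) ∧
    -- the identity
    (∀ (k : ℕ) (M : GenExtrap.Scheme k), (∑ i, M.b i = 1) →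
      35 / 4 * M.G31 - 63 / 2 * M.G51 + 35 * M.G63t + 36 * M.G71 - 420 * M.G72
        + 10080 * M.G73 - 420 * M.G74 = 1) ∧
    -- order seven is impossible, for formal series and for actual integrators
    (∀ (k : ℕ) (M : GenExtrap.Scheme k), ¬ M.HasFormalOrder 7 ∧ ¬ M.HasOrder 7) ∧
    -- if all terms up to order seven but that of `E73` vanish, then the latter is `1 / 10080`
    (∀ (k : ℕ) (M : GenExtrap.Scheme k), M.OrderSixConditions →
      M.OrderSevenTermsVanishExceptG73 → M.G73 = 1 / 10080) ∧
    -- and this does happen, with four compositions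
    (∃ M : GenExtrap.Scheme 4, M.OrderSixConditions ∧ M.OrderSevenTermsVanishExceptG73 ∧
      M.G73 = 1 / 10080 ∧
      ∀ n ≤ 7, PowerSeries.coeff n M.series =
        PowerSeries.coeff n (GenExtrap.flowSeries (1 / 2) *
          (1 + PowerSeries.monomial 7 ((1 / 10080 : ℝ) • GenExtrap.E73)) *
            GenExtrap.flowSeries (1 / 2))) := by
  refine ⟨GenExtrap.existsUnique_isErrorCoeffs, fun k M => M.relation, fun k M =>
    ⟨M.not_hasFormalOrder_seven, M.not_hasOrder_seven⟩, fun k M => M.G73_eq, ?_⟩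
  obtain ⟨M, h6, h7⟩ := GenExtrap.exists_orderConditions
  have h := M.series_eqUpTo h6 h7
  rw [M.G73_eq h6 h7] at h
  exact ⟨M, h6, h7, M.G73_eq h6 h7, h⟩
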